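/- Let $X$ be a spectrally negative Lévy process with Lévy triplet $(\gamma,\sigma,\Pi)$, where $\gamma\in\mathbb R$, $\sigma>0$ and $\Pi$ is a measure concentrated on $(0,\infty)$ with $\int_{(0,\infty)}(1\wedge x^2)\,\Pi(dx)<\infty$, and with Laplace exponent $$\psi_X(\theta)=\gamma\theta+\tfrac12\sigma^2\theta^2-\int_{(0,\infty)}\bigl(1-e^{-\theta z}-\theta z1_{\{0<z<1\}}\bigr)\,\Pi(dz),\qquad \theta\ge 0.$$ Let $q>0$, $\delta>0$, $S>0$, and put $\Phi(q)=\sup\{\theta\ge 0:\psi_X(\theta)=q\}$, $\phi(q)=\sup\{\theta\ge 0:\psi_X(\theta)-\delta\theta=q\}$ and $c=\gamma+\int_{(0,1)}z\,\Pi(dz)$. Assume $(\circledast)$: $\phi(q)<2\delta/\sigma^2$; $\Pi(0,\infty)<\infty$; $\Pi$ has a completely monotone density (a density $\rho\ge 0$ that is infinitely differentiable on $(0,\infty)$ with $(-1)^n\rho^{(n)}(x)\ge 0$ for all $n\ge 1$ and $x>0$); and $S<\dfrac{c}{\Pi(0,\infty)+q}$. Let $W^{(q)}:\mathbb R\to[0,\infty)$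 be the $q$-scale function of $X$, that is, $W^{(q)}=0$ on $(-\infty,0)$, $W^{(q)}$ is continuous and strictly increasing on $[0,\infty)$, and $\int_0^\infty e^{-\theta x}W^{(q)}(x)\,dx=\dfrac1{\psi_X(\theta)-q}$ for all $\theta>\Phi(q)$. Define $$\theta_S(b)=\frac{1-S\frac{\sigma^2}{2}W^{(q)\prime\prime}(b)}{W^{(q)\prime}(b)}\quad(b>0),\qquad a_S^*=\inf\{b\ge 0:\theta_S'(b)\le 0\},$$ with $\theta_S'(0)=\theta_S'(0+)$ and $\inf\emptyset=\infty$, and let $a^*\ge 0$ be the largest point of $[0,\infty)$ at which $W^{(q)\prime}$ (with $W^{(q)\prime}(0)=W^{(q)\prime}(0+)$) attains its global infimum. Then these objects are well defined ($W^{(q)}$ is three times continuously differentiable and $W^{(q)\prime}>0$ on $(0,\infty)$, the limits $W^{(q)\prime}(0+)$ and $\theta_S'(0+)$ exist and are finite, and $a^*$ exists and is finite), and $$\theta_S\text{ is strictly increasing on }(0,a_S^*)\text{ and strictly decreasing on }(a_S^*,\infty),\qquad a_S^*\le a^*.$$ -/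

import Mathlib

open Set Filter Topology MeasureTheory
open scoped ContDiff

noncomputable section

/-- The Lévy triplet `(γ, σ, Π)` of a spectrally negative Lévy process (`jump` is the measure `Π`;
a point `z > 0` in its support stands for a downward jump of size `z`). -/
structure LevyTriplet where
  γ : ℝ
  σ : ℝ
  jump : Measure ℝ
  σ_nonneg : 0 ≤ σ
  jump_Iic : jump (Iic 0) = 0
  jump_integrable : ∫⁻ x, ENNReal.ofReal (min 1 (x ^ 2)) ∂jump < ⊤

namespace LevyTriplet

/-- The Laplace exponent `ψ_X`, given by the Lévy-Khintchine formula. -/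
def laplaceExponent (X : LevyTriplet) (θ : ℝ) : ℝ :=
  X.γ * θ + X.σ ^ 2 / 2 * θ ^ 2
    - ∫ z in Ioi 0, (1 - Real.exp (-θ * z) - θ * z * (Ioo (0 : ℝ) 1).indicator 1 z) ∂X.jump

/-- The drift `c = γ + ∫_{(0,1)} z Π(dz)`. -/
def drift (X : LevyTriplet) : ℝ :=
  X.γ + ∫ z in Ioo 0 1, z ∂X.jump

/-- `Φ(q) = sup {θ ≥ 0 : ψ_X(θ) = q}`. -/
def Phi (X : LevyTriplet) (q : ℝ) : ℝ :=
  sSup {θ : ℝ | 0 ≤ θ ∧ X.laplaceExponent θ = q}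

/-- `φ(q) = sup {θ ≥ 0 : ψ_X(θ) - δ θ = q}`: the right inverse of the Laplace exponent of the
process `Y_t = X_t - δ t`. -/
def phi (X : LevyTriplet) (δ q : ℝ) : ℝ :=
  sSup {θ : ℝ | 0 ≤ θ ∧ X.laplaceExponent θ - δ * θ = q}

/-- The measure `Π` has a completely monotone density on `(0, ∞)`. -/
def HasCompletelyMonotoneDensity (X : LevyTriplet) : Prop :=
  ∃ ρ : ℝ → ℝ, ContDiffOn ℝ ∞ ρ (Ioi 0) ∧
    (∀ n : ℕ, ∀ x : ℝ, 0 < x → 0 ≤ (-1) ^ n * iteratedDeriv n ρ x) ∧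
    X.jump = (volume.restrict (Ioi 0)).withDensity (fun x => ENNReal.ofReal (ρ x))

/-- `W` is the `q`-scale function of the process with triplet `X`: the function that vanishes on
`(-∞, 0)`, is nonnegative, continuous and strictly increasing on `[0, ∞)`, and has Laplace
transform `1 / (ψ_X(θ) - q)` for `θ > Φ(q)`. -/
structure IsScaleFunction (X : LevyTriplet) (q : ℝ) (W : ℝ → ℝ) : Prop where
  eq_zero_of_neg : ∀ x < 0, W x = 0
  nonneg : ∀ x, 0 ≤ W x
  continuousOn : ContinuousOn W (Ici 0)
  strictMonoOn : StrictMonoOn W (Ici 0)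
  integrableOn : ∀ θ > X.Phi q, IntegrableOn (fun x => Real.exp (-θ * x) * W x) (Ioi 0)
  laplace : ∀ θ > X.Phi q,
    ∫ x in Ioi 0, Real.exp (-θ * x) * W x = 1 / (X.laplaceExponent θ - q)

end LevyTriplet

/-- A function on `(0, ∞)`, given at the origin the value of its right limit `f(0+)`. -/
def extendZero (f : ℝ → ℝ) (b : ℝ) : ℝ :=
  if b = 0 then limUnder (𝓝[>] 0) f else f b

/-- The points of `[0, ∞)` at which `W'` (with `W'(0) = W'(0+)`) attains its global infimum;
the largest of them is `a*`. -/
def derivMinimizers (W : ℝ → ℝ) : Set ℝ :=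
  {a : ℝ | 0 ≤ a ∧ ∀ x : ℝ, 0 ≤ x → extendZero (deriv W) a ≤ extendZero (deriv W) x}

/-- `θ_S(b) = (1 - S (σ² / 2) W''(b)) / W'(b)`, used for `b > 0`. -/
def thetaS (σ S : ℝ) (W : ℝ → ℝ) (b : ℝ) : ℝ :=
  (1 - S * (σ ^ 2 / 2) * iteratedDeriv 2 W b) / deriv W b

/-- `a_S^* = inf {b ≥ 0 : θ_S'(b) ≤ 0}` with `θ_S'(0) = θ_S'(0+)` and `inf ∅ = ∞`. -/
def aStarS (σ S : ℝ) (W : ℝ → ℝ) : EReal :=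
  sInf ((fun b : ℝ => (b : EReal)) ''
    {b : ℝ | 0 ≤ b ∧ extendZero (deriv (thetaS σ S W)) b ≤ 0})

end

/-! Write κ = σ²/2, Φ = Φ(q), U = κW and r = U' - ΦU. Factoring θ - Φ out of ψ_X(θ) - q turns the
Laplace transform of W into a Volterra equation r' = -βr + m * r, r(0) = 1, with β = Φ + c/κ and
m(x) = κ⁻¹ ∫ₓ^∞ e^{Φ(x-y)} ρ(y) dy (`IsScaleFunction.exists_reduced`). The kernel m inherits
complete monotonicity from ρ.

Complete monotonicity is used through exponential sums. On compact intervals m is a uniform limit of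
Σ cᵢ e^{-tᵢx} with cᵢ ≥ 0 (`exists_exp_sum_near`). For such a kernel, r is a diagonal entry of
exp(xA) with A real symmetric, hence a sum of exponentials with nonnegative weights
(`exists_expSum_solution`). Stability of the equation carries this over to the limit. Consequently
r'' > 0 and r'' is log-convex, in the sense that e^{αx} r''(x) is convex for every α. Also r' ≤ 0,
because m has mass at most β.

Put k = -e^{-Φx}U'' and p = e^{-Φx}r'', so that k' = -p < 0. Up to a positive factor, θ_S' is N =
k(1 - S r') - S U' p. Where k ≤ 0, N < 0. Where k > 0, N = k(1 - S K) with K = U'p/k + r' and K' =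
U'(p'k + p²)/k². Since p'/p is nondecreasing, K keeps increasing once K' > 0
(`numerator_neg_of_lt`). The bound on S says N(0) > 0, that is K(0) < 1/S; so K can reach 1/S only
after a point where K' > 0, and from then on N stays negative. Thus θ_S increases and then
decreases. The unique zero of U'' is a*; N < 0 there, which gives a_S* ≤ a*. -/

noncomputable section

/-! ### Convolution on the half-line -/

/-- The convolution `(f * g)(x) = ∫₀ˣ f(t) g(x - t) dt` on the half-line. -/
def halfConv (f g : ℝ → ℝ) (x : ℝ) : ℝ := ∫ t in (0 : ℝ)..x, f t * g (x - t)

theorem halfConv_zero (f g : ℝ → ℝ) : halfConv f g 0 = 0 := by simp [halfConv]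

theorem continuous_halfConv {f g : ℝ → ℝ} (hf : Continuous f) (hg : Continuous g) :
    Continuous (halfConv f g) := by
  unfold halfConv
  exact intervalIntegral.continuous_parametric_intervalIntegral_of_continuous
    (f := fun x t => f t * g (x - t)) (by simp only [Function.uncurry_def]; fun_prop) continuous_id

/-- Exchange of the order of integration over the triangle `0 < y < t < x`. -/
theorem integral_halfConv {f g : ℝ → ℝ} (hf : Continuous f) (hg : Continuous g) {x : ℝ}
    (hx : 0 ≤ x) :
    ∫ t in (0 : ℝ)..x, halfConv f g t = ∫ y in (0 : ℝ)..x, f y * ∫ u in (0 : ℝ)..(x - y), g u := by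
  have hF : Continuous (fun p : ℝ × ℝ => f p.2 * g (p.1 - p.2)) := by fun_prop
  have hS : MeasurableSet {p : ℝ × ℝ | p.2 ≤ p.1} :=
    measurableSet_le measurable_snd measurable_fst
  have hint : Integrable (Function.uncurry fun t y : ℝ =>
      {p : ℝ × ℝ | p.2 ≤ p.1}.indicator (fun p => f p.2 * g (p.1 - p.2)) (t, y))
      ((volume.restrict (Ioc 0 x)).prod (volume.restrict (Ioc 0 x))) := by
    have h0 : IntegrableOn (fun p : ℝ × ℝ => f p.2 * g (p.1 - p.2)) (Ioc 0 x ×ˢ Ioc 0 x)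
        (volume.prod volume) := by
      refine (hF.continuousOn.integrableOn_compact (K := Icc 0 x ×ˢ Icc 0 x)
        (isCompact_Icc.prod isCompact_Icc)).mono_set ?_
      exact prod_mono Ioc_subset_Icc_self Ioc_subset_Icc_self
    rw [IntegrableOn, ← Measure.prod_restrict] at h0
    exact h0.indicator hS
  have hsw := integral_integral_swap hint
  rw [intervalIntegral.integral_of_le hx, intervalIntegral.integral_of_le hx]
  calc ∫ t in Ioc 0 x, halfConv f g t
      = ∫ t in Ioc 0 x, ∫ y in Ioc 0 x,
          {p : ℝ × ℝ | p.2 ≤ p.1}.indicator (fun p => f p.2 * g (p.1 - p.2)) (t, y) := by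
        refine setIntegral_congr_fun measurableSet_Ioc fun t ht => ?_
        have : (fun y => {p : ℝ × ℝ | p.2 ≤ p.1}.indicator (fun p => f p.2 * g (p.1 - p.2)) (t, y))
            = (Iic t).indicator (fun y => f y * g (t - y)) := by
          ext y; simp [indicator]
        simp only [this]
        rw [setIntegral_indicator measurableSet_Iic, Ioc_inter_Iic, min_eq_right ht.2, halfConv,
          intervalIntegral.integral_of_le ht.1.le]
    _ = _ := hsw
    _ = _ := by
        refine setIntegral_congr_fun measurableSet_Ioc fun y hy => ?_
        have : (fun t => {p : ℝ × ℝ | p.2 ≤ p.1}.indicator (fun p => f p.2 * g (p.1 - p.2)) (t, y))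
            = (Ici y).indicator (fun t => f y * g (t - y)) := by
          ext t; simp [indicator]
        simp only [this]
        rw [setIntegral_indicator measurableSet_Ici]
        have hset : Ioc 0 x ∩ Ici y = Icc y x := by
          ext t; simp only [mem_inter_iff, mem_Ioc, mem_Ici, mem_Icc]
          constructor
          · rintro ⟨⟨_, h2⟩, h3⟩; exact ⟨h3, h2⟩
          · rintro ⟨h1, h2⟩; exact ⟨⟨hy.1.trans_le h1, h2⟩, h1⟩
        rw [hset, integral_Icc_eq_integral_Ioc, ← intervalIntegral.integral_of_le hy.2,
          intervalIntegral.integral_const_mul, intervalIntegral.integral_comp_sub_right, sub_self]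

/-- Write h(x - y) as h(0) plus the integral of `h₁`, integrate against m and exchange the
integrals. -/
theorem halfConv_eq_integral {m h h₁ : ℝ → ℝ} (hm : Continuous m) (hh : Continuous h)
    (hh₁ : Continuous h₁) (hd : ∀ x > 0, HasDerivAt h (h₁ x) x) {x : ℝ} (hx : 0 ≤ x) :
    halfConv m h x = ∫ t in (0 : ℝ)..x, (m t * h 0 + halfConv m h₁ t) := by
  rw [intervalIntegral.integral_add (f := fun t => m t * h 0)
    ((hm.mul continuous_const).intervalIntegrable _ _)
    ((continuous_halfConv hm hh₁).intervalIntegrable _ _), integral_halfConv hm hh₁ hx]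
  have hprim : ∀ z, 0 ≤ z → ∫ u in (0 : ℝ)..z, h₁ u = h z - h 0 := fun z hz =>
    intervalIntegral.integral_eq_sub_of_hasDerivAt_of_le hz hh.continuousOn
      (fun y hy => hd y hy.1) (hh₁.intervalIntegrable _ _)
  have : ∫ y in (0 : ℝ)..x, m y * ∫ u in (0 : ℝ)..(x - y), h₁ u
      = ∫ y in (0 : ℝ)..x, (m y * h (x - y) - m y * h 0) := by
    refine intervalIntegral.integral_congr fun y hy => ?_
    rw [uIcc_of_le hx] at hy
    simp only [hprim (x - y) (by linarith [hy.2])]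
    ring
  rw [this, intervalIntegral.integral_sub (f := fun y => m y * h (x - y))
    (g := fun y => m y * h 0) ((by fun_prop : Continuous fun y => m y * h (x - y)).intervalIntegrable _ _)
    ((hm.mul continuous_const).intervalIntegrable _ _),
    halfConv]
  ring

/-- The derivative falls on h alone. The kernel m is only continuous, and this matters: the kernel
used later may have infinite slope at the origin. -/
theorem hasDerivAt_halfConv {m h h₁ : ℝ → ℝ} (hm : Continuous m) (hh : Continuous h)
    (hh₁ : Continuous h₁) (hd : ∀ x > 0, HasDerivAt h (h₁ x) x) {x : ℝ} (hx : 0 < x) :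
    HasDerivAt (halfConv m h) (m x * h 0 + halfConv m h₁ x) x := by
  have hc : Continuous fun t => m t * h 0 + halfConv m h₁ t :=
    (hm.mul continuous_const).add (continuous_halfConv hm hh₁)
  refine (hc.integral_hasStrictDerivAt 0 x).hasDerivAt.congr_of_eventuallyEq ?_
  filter_upwards [Ioi_mem_nhds hx] with y hy
  exact halfConv_eq_integral hm hh hh₁ hd (le_of_lt hy)

theorem halfConv_comm (f g : ℝ → ℝ) (x : ℝ) : halfConv f g x = halfConv g f x := by
  have := intervalIntegral.integral_comp_sub_left (a := 0) (b := x)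
    (fun t => f t * g (x - t)) x
  simp only [sub_sub_cancel, sub_self, sub_zero] at this
  rw [halfConv, ← this, halfConv]
  exact intervalIntegral.integral_congr fun t _ => mul_comm _ _

/-! ### Laplace transforms and their injectivity on continuous functions -/

/-- `HasLaplace f θ L`: the integral `∫₀^∞ e^{-θx} f(x) dx` converges absolutely, to `L`. -/
def HasLaplace (f : ℝ → ℝ) (θ L : ℝ) : Prop :=
  IntegrableOn (fun x => Real.exp (-θ * x) * f x) (Ioi 0) ∧
    ∫ x in Ioi 0, Real.exp (-θ * x) * f x = L

namespace HasLaplace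

variable {f g : ℝ → ℝ} {θ L M : ℝ}

theorem add (hf : HasLaplace f θ L) (hg : HasLaplace g θ M) :
    HasLaplace (fun x => f x + g x) θ (L + M) := by
  refine ⟨?_, ?_⟩
  · simp only [mul_add]; exact Integrable.add hf.1 hg.1
  · simp only [mul_add]
    rw [integral_add hf.1 hg.1, hf.2, hg.2]

theorem const_mul (c : ℝ) (hf : HasLaplace f θ L) : HasLaplace (fun x => c * f x) θ (c * L) := by
  have : (fun x => Real.exp (-θ * x) * (c * f x)) = fun x => c * (Real.exp (-θ * x) * f x) := by
    ext x; ring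
  refine ⟨?_, ?_⟩
  · rw [this]; exact hf.1.const_mul c
  · rw [this, integral_const_mul, hf.2]

theorem sub (hf : HasLaplace f θ L) (hg : HasLaplace g θ M) :
    HasLaplace (fun x => f x - g x) θ (L - M) := by
  simpa [sub_eq_add_neg] using hf.add (hg.const_mul (-1))

theorem congr (hf : HasLaplace f θ L) (h : ∀ x > 0, f x = g x) : HasLaplace g θ L := by
  have : EqOn (fun x => Real.exp (-θ * x) * f x) (fun x => Real.exp (-θ * x) * g x) (Ioi 0) :=
    fun x hx => by simp only [h x hx]
  exact ⟨hf.1.congr_fun this measurableSet_Ioi,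
    (setIntegral_congr_fun measurableSet_Ioi this).symm.trans hf.2⟩

theorem conv (hf : HasLaplace f θ L) (hg : HasLaplace g θ M) :
    HasLaplace (halfConv f g) θ (L * M) := by
  have key : ∀ x : ℝ, Real.exp (-θ * x) * halfConv f g x = ∫ t in (0 : ℝ)..x,
      ContinuousLinearMap.mul ℝ ℝ (Real.exp (-θ * t) * f t)
        (Real.exp (-θ * (x - t)) * g (x - t)) := by
    intro x
    rw [halfConv, ← intervalIntegral.integral_const_mul]
    refine intervalIntegral.integral_congr fun t _ => ?_
    have : Real.exp (-θ * x) = Real.exp (-θ * t) * Real.exp (-θ * (x - t)) := by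
      rw [← Real.exp_add]; ring_nf
    simp only [ContinuousLinearMap.mul_apply', this]
    ring
  have h1 := integrable_posConvolution hf.1 hg.1 (ContinuousLinearMap.mul ℝ ℝ)
  have h2 := integral_posConvolution hf.1 hg.1 (ContinuousLinearMap.mul ℝ ℝ)
  refine ⟨?_, ?_⟩
  · simp only [key]
    exact h1.integrableOn.congr_fun (s := Ioi 0) (fun x hx => by
      simp only [posConvolution, indicator_of_mem hx]) measurableSet_Ioi
  · simp only [key]
    rw [h2, hf.2, hg.2]
    rfl

theorem one (hθ : 0 < θ) : HasLaplace (fun _ => 1) θ (1 / θ) := by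
  refine ⟨?_, ?_⟩
  · simpa using integrableOn_exp_mul_Ioi (a := -θ) (by linarith) 0
  · simp only [mul_one]
    rw [integral_exp_mul_Ioi (by linarith : -θ < 0) 0]
    simp

theorem id (hθ : 0 < θ) : HasLaplace (fun x => x) θ (1 / θ * (1 / θ)) := by
  refine ((one hθ).conv (one hθ)).congr fun x _ => ?_
  simp [halfConv]

end HasLaplace

/-- After the substitution u = e^{-x}, the transforms at positive integers are the moments of a
function on (0, 1]. -/
theorem integral_polynomial_exp_mul_eq_zero {F : ℝ → ℝ}
    (h : ∀ n : ℕ, HasLaplace F (n + 1) 0) (P : Polynomial ℝ) :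
    IntegrableOn (fun x => Real.exp (-x) * P.eval (Real.exp (-x)) * F x) (Ioi 0) ∧
    ∫ x in Ioi 0, Real.exp (-x) * P.eval (Real.exp (-x)) * F x = 0 := by
  induction P using Polynomial.induction_on' with
  | add p q hp hq =>
    have : (fun x => Real.exp (-x) * (p + q).eval (Real.exp (-x)) * F x) = fun x =>
        Real.exp (-x) * p.eval (Real.exp (-x)) * F x
          + Real.exp (-x) * q.eval (Real.exp (-x)) * F x := by
      ext x; rw [Polynomial.eval_add]; ring
    refine ⟨?_, ?_⟩
    · rw [this]; exact Integrable.add hp.1 hq.1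
    · rw [this, integral_add hp.1 hq.1, hp.2, hq.2, add_zero]
  | monomial n a =>
    have : (fun x => Real.exp (-x) * (Polynomial.monomial n a).eval (Real.exp (-x)) * F x)
        = fun x => a * (Real.exp (-((n : ℝ) + 1) * x) * F x) := by
      ext x
      have : Real.exp (-((n : ℝ) + 1) * x) = Real.exp (-x) * Real.exp (-x) ^ n := by
        rw [← Real.exp_nat_mul, ← Real.exp_add]; ring_nf
      rw [Polynomial.eval_monomial, this]; ring
    refine ⟨?_, ?_⟩
    · rw [this]; exact (h n).1.const_mul a
    · rw [this, integral_const_mul, (h n).2, mul_zero]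

/-- A bounded continuous function that vanishes at infinity and whose Laplace transform vanishes
at the positive integers is zero. -/
theorem eq_zero_of_laplace_nat_eq_zero {F : ℝ → ℝ} (hF : Continuous F)
    (hlim : Tendsto F atTop (𝓝 0)) (h : ∀ n : ℕ, HasLaplace F (n + 1) 0) :
    ∀ x > 0, F x = 0 := by
  -- The substitution u = e^{-x} compactifies the half-line; the value 0 at u = 0 is the limit of F
  -- at infinity, so Weierstrass approximation applies on [0, 1].
  let H : ℝ → ℝ := fun u => if u ≤ 0 then 0 else F (-Real.log u)
  have hH : ContinuousOn H (Icc 0 1) := by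
    intro u hu
    rcases hu.1.eq_or_lt with h0 | h0
    · subst h0
      have h1 : Tendsto H (𝓝[>] 0) (𝓝 0) := by
        have : Tendsto (fun u => F (-Real.log u)) (𝓝[>] 0) (𝓝 0) :=
          hlim.comp (tendsto_neg_atBot_atTop.comp Real.tendsto_log_nhdsGT_zero)
        refine this.congr' ?_
        filter_upwards [self_mem_nhdsWithin] with v hv
        simp [H, not_le.2 (mem_Ioi.1 hv)]
      have h2 : ContinuousWithinAt H (Ioi 0) 0 := by
        rw [ContinuousWithinAt]; simpa [H] using h1
      refine (continuousWithinAt_insert_self.2 h2).mono ?_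
      intro v hv
      rcases hv.1.eq_or_lt with h | h
      · left; exact h.symm
      · right; exact h
    · refine ContinuousAt.continuousWithinAt ?_
      have : ContinuousAt (fun u => F (-Real.log u)) u :=
        hF.continuousAt.comp (Real.continuousAt_log h0.ne').neg
      refine this.congr ?_
      filter_upwards [Ioi_mem_nhds h0] with v hv
      simp [H, not_le.2 (mem_Ioi.1 hv)]
  have happ : ∀ ε > 0, ∃ P : Polynomial ℝ, ∀ x > 0, |P.eval (Real.exp (-x)) - F x| < ε := by
    intro ε hε
    obtain ⟨P, hP⟩ := exists_polynomial_near_of_continuousOn 0 1 H hH ε hε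
    refine ⟨P, fun x hx => ?_⟩
    have := hP (Real.exp (-x)) ⟨(Real.exp_pos _).le, Real.exp_le_one_iff.2 (by linarith)⟩
    simpa [H, not_le.2 (Real.exp_pos (-x))] using this
  have hint : IntegrableOn (fun x => Real.exp (-x) * F x) (Ioi 0) := by
    have := (h 0).1
    simpa using this
  obtain ⟨P₁, hP₁⟩ := happ 1 one_pos
  obtain ⟨C, hC⟩ : ∃ C, ∀ u ∈ Icc (0 : ℝ) 1, |P₁.eval u| ≤ C :=
    isCompact_Icc.exists_bound_of_continuousOn (f := fun u => P₁.eval u)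
      P₁.continuous.continuousOn
  have hbd : ∀ x > 0, |F x| ≤ C + 1 := by
    intro x hx
    have h1 := (hP₁ x hx).le
    have h2 := hC (Real.exp (-x)) ⟨(Real.exp_pos _).le, Real.exp_le_one_iff.2 (by linarith)⟩
    rw [abs_le] at *
    constructor <;> linarith [h1.1, h1.2, h2.1, h2.2]
  have hint2 : IntegrableOn (fun x => Real.exp (-x) * F x ^ 2) (Ioi 0) := by
    have : IntegrableOn (fun x => F x * (Real.exp (-x) * F x)) (Ioi 0) := by
      refine Integrable.bdd_mul (c := C + 1) hint hF.aestronglyMeasurable ?_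
      filter_upwards [ae_restrict_mem measurableSet_Ioi] with x hx
      exact hbd x hx
    refine this.congr_fun (fun x _ => by ring) measurableSet_Ioi
  set I := ∫ x in Ioi 0, Real.exp (-x) * F x ^ 2 with hI
  -- By orthogonality to polynomials in e^{-x}, ∫ e^{-x}F² = ∫ e^{-x}F(F - P), and |F - P| < ε.
  have hIle : ∀ ε > 0, I ≤ ε * ∫ x in Ioi 0, |Real.exp (-x) * F x| := by
    intro ε hε
    obtain ⟨P, hP⟩ := happ ε hε
    obtain ⟨hp1, hp2⟩ := integral_polynomial_exp_mul_eq_zero h P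
    have : I = ∫ x in Ioi 0, (Real.exp (-x) * F x ^ 2
        - Real.exp (-x) * P.eval (Real.exp (-x)) * F x) := by
      rw [integral_sub hint2 hp1, hp2, sub_zero]
    rw [this, ← integral_const_mul]
    refine setIntegral_mono_on (hint2.sub hp1) (hint.abs.const_mul ε) measurableSet_Ioi ?_
    intro x hx
    have h1 := (hP x hx).le
    calc Real.exp (-x) * F x ^ 2 - Real.exp (-x) * P.eval (Real.exp (-x)) * F x
        = -(P.eval (Real.exp (-x)) - F x) * (Real.exp (-x) * F x) := by ring
      _ ≤ |-(P.eval (Real.exp (-x)) - F x) * (Real.exp (-x) * F x)| := le_abs_self _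
      _ = |P.eval (Real.exp (-x)) - F x| * |Real.exp (-x) * F x| := by rw [abs_mul, abs_neg]
      _ ≤ _ := mul_le_mul_of_nonneg_right h1 (abs_nonneg _)
  have hI0 : I = 0 := by
    refine le_antisymm ?_ (setIntegral_nonneg measurableSet_Ioi fun x _ => by positivity)
    set B := ∫ x in Ioi 0, |Real.exp (-x) * F x|
    have hB : 0 ≤ B := setIntegral_nonneg measurableSet_Ioi fun x _ => abs_nonneg _
    refine le_of_forall_pos_le_add fun ε hε => ?_
    have := hIle (ε / (B + 1)) (by positivity)
    have h3 : ε / (B + 1) * B ≤ ε := by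
      rw [div_mul_eq_mul_div, div_le_iff₀ (by positivity)]; nlinarith
    linarith
  have hae : (fun x => Real.exp (-x) * F x ^ 2) =ᵐ[volume.restrict (Ioi 0)] 0 :=
    (setIntegral_eq_zero_iff_of_nonneg_ae (ae_of_all _ fun x => by
      simp only [Pi.zero_apply]; positivity) hint2).1 hI0
  have heq := Measure.eqOn_of_ae_eq hae (by fun_prop) (by fun_prop)
    (by rw [interior_Ioi]; exact subset_closure)
  intro x hx
  have := heq hx
  simp only [Pi.zero_apply, mul_eq_zero, (Real.exp_pos _).ne', false_or] at this
  exact pow_eq_zero_iff two_ne_zero |>.1 this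

/-- A continuous function is determined on the half-line by its Laplace transform. -/
theorem eq_zero_of_hasLaplace_zero {f : ℝ → ℝ} (hf : Continuous f) {θ₀ : ℝ}
    (h : ∀ θ > θ₀, HasLaplace f θ 0) : ∀ x ≥ 0, f x = 0 := by
  set g : ℝ → ℝ := fun x => Real.exp (-(θ₀ + 1) * x) * f x with hg
  have hgc : Continuous g := by fun_prop
  have hgL : ∀ n : ℕ, HasLaplace g (n + 1) 0 := by
    intro n
    have h1 := h (θ₀ + 1 + (n + 1)) (by have : (0 : ℝ) ≤ n := n.cast_nonneg; linarith)
    have : (fun x => Real.exp (-((n : ℝ) + 1) * x) * g x)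
        = fun x => Real.exp (-(θ₀ + 1 + (n + 1)) * x) * f x := by
      ext x
      rw [hg]; simp only
      rw [← mul_assoc, ← Real.exp_add]; ring_nf
    refine ⟨?_, ?_⟩
    · rw [this]; exact h1.1
    · rw [this]; exact h1.2
  -- The primitive of g replaces g because it tends to 0 at infinity: its limit is the transform of
  -- f at θ₀ + 1.
  have hFc : Continuous (halfConv g fun _ => 1) := continuous_halfConv hgc continuous_const
  have hF : ∀ x, halfConv g (fun _ => 1) x = ∫ t in (0 : ℝ)..x, g t := fun x => by simp [halfConv]
  have hlim : Tendsto (halfConv g fun _ => 1) atTop (𝓝 0) := by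
    have h1 := h (θ₀ + 1) (by linarith)
    have := intervalIntegral_tendsto_integral_Ioi 0 h1.1 tendsto_id
    rw [h1.2] at this
    exact this.congr fun x => (hF x).symm
  have hz := eq_zero_of_laplace_nat_eq_zero hFc hlim fun n => by
    simpa using (hgL n).conv (HasLaplace.one (by positivity : (0 : ℝ) < n + 1))
  have hpos : ∀ x > 0, f x = 0 := by
    intro x hx
    have h1 : HasDerivAt (fun x => ∫ t in (0 : ℝ)..x, g t) (g x) x :=
      (hgc.integral_hasStrictDerivAt 0 x).hasDerivAt
    have h2 : HasDerivAt (fun x => ∫ t in (0 : ℝ)..x, g t) 0 x := by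
      refine (hasDerivAt_const x (0 : ℝ)).congr_of_eventuallyEq ?_
      filter_upwards [Ioi_mem_nhds hx] with y hy
      rw [← hF, hz y hy]
    have h3 := h1.unique h2
    simpa [hg, (Real.exp_pos _).ne'] using h3
  intro x hx
  have hcl : EqOn f 0 (closure (Ioi 0)) :=
    EqOn.closure (fun y hy => hpos y hy) hf continuous_zero
  rw [closure_Ioi] at hcl
  exact hcl hx

/-! ### Bernstein-type approximation of completely monotone functions -/

/-- `a n = (-1)ⁿ f⁽ⁿ⁾` for a completely monotone function `f = a 0` on `(0, ∞)`. -/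
structure IsCompletelyMonotoneChain (a : ℕ → ℝ → ℝ) : Prop where
  nonneg : ∀ n, ∀ x > 0, 0 ≤ a n x
  hasDerivAt : ∀ n, ∀ x > 0, HasDerivAt (a n) (-a (n + 1) x) x

/-- The Taylor polynomial of `a 0` of degree less than `N` at `y`. -/
def chainTaylor (a : ℕ → ℝ → ℝ) (N : ℕ) (y x : ℝ) : ℝ :=
  ∑ k ∈ Finset.range N, a k y * ((y - x) ^ k / k.factorial)

/-- The remainder of the Taylor polynomial of `a 0`. -/
def chainRemainder (a : ℕ → ℝ → ℝ) (N : ℕ) (y x : ℝ) : ℝ := a 0 x - chainTaylor a N y x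

/-- Differentiation in x shifts the chain, so the remainder estimates can be proved by induction on
the degree, over all chains at once. -/
theorem hasDerivAt_chainTaylor_succ (a : ℕ → ℝ → ℝ) (N : ℕ) (y x : ℝ) :
    HasDerivAt (chainTaylor a (N + 1) y) (-chainTaylor (fun n => a (n + 1)) N y x) x := by
  have h : chainTaylor a (N + 1) y = fun x =>
      ∑ k ∈ Finset.range N, a (k + 1) y * ((y - x) ^ (k + 1) / (k + 1).factorial) + a 0 y := by
    ext x; simp [chainTaylor, Finset.sum_range_succ']
  rw [h, chainTaylor, ← Finset.sum_neg_distrib]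
  refine (HasDerivAt.fun_sum fun k _ => ?_).add_const _
  have h1 : HasDerivAt (fun x => (y - x) ^ (k + 1)) (((k : ℝ) + 1) * (y - x) ^ k * -1) x := by
    have := ((hasDerivAt_id x).const_sub y).fun_pow (k + 1)
    simpa using this
  have h2 := (h1.div_const ((k + 1).factorial : ℝ)).const_mul (a (k + 1) y)
  refine h2.congr_deriv ?_
  have : ((k : ℝ) + 1) ≠ 0 := by positivity
  rw [Nat.factorial_succ]; push_cast
  field_simp

theorem chainTaylor_self (a : ℕ → ℝ → ℝ) (N : ℕ) (y : ℝ) : chainTaylor a (N + 1) y y = a 0 y := by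
  simp [chainTaylor, Finset.sum_range_succ']

theorem chainRemainder_self (a : ℕ → ℝ → ℝ) (N : ℕ) (y : ℝ) :
    chainRemainder a (N + 1) y y = 0 := by
  simp [chainRemainder, chainTaylor_self]

namespace IsCompletelyMonotoneChain

variable {a : ℕ → ℝ → ℝ}

theorem shift (h : IsCompletelyMonotoneChain a) :
    IsCompletelyMonotoneChain fun n => a (n + 1) :=
  ⟨fun n => h.nonneg (n + 1), fun n => h.hasDerivAt (n + 1)⟩

theorem hasDerivAt_remainder (h : IsCompletelyMonotoneChain a) (N : ℕ) {y x : ℝ} (hx : 0 < x) :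
    HasDerivAt (chainRemainder a (N + 1) y) (-chainRemainder (fun n => a (n + 1)) N y x) x := by
  refine ((h.hasDerivAt 0 x hx).sub (hasDerivAt_chainTaylor_succ a N y x)).congr_deriv ?_
  simp only [chainRemainder]; ring

/-- The remainder vanishes at y, and its derivative is minus the remainder of the shifted chain,
which has a sign by induction. -/
theorem remainder_nonneg (N : ℕ) : ∀ {a : ℕ → ℝ → ℝ}, IsCompletelyMonotoneChain a →
    ∀ {y x : ℝ}, 0 < x → x ≤ y → 0 ≤ chainRemainder a N y x := by
  induction N with
  | zero => intro a h y x hx _; simpa [chainRemainder, chainTaylor] using h.nonneg 0 x hx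
  | succ N ih =>
    intro a h y x hx hxy
    have hanti : AntitoneOn (chainRemainder a (N + 1) y) (Icc x y) := by
      refine antitoneOn_of_hasDerivWithinAt_nonpos (convex_Icc x y)
        (fun z hz => (h.hasDerivAt_remainder N (hx.trans_le hz.1)).continuousAt.continuousWithinAt)
        (fun z hz => (h.hasDerivAt_remainder N ?_).hasDerivWithinAt) fun z hz => ?_
      · rw [interior_Icc] at hz; exact hx.trans hz.1
      · rw [interior_Icc] at hz
        exact neg_nonpos.2 (ih h.shift (hx.trans hz.1) hz.2.le)
    have := hanti ⟨le_rfl, hxy⟩ ⟨hxy, le_rfl⟩ hxy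
    rwa [chainRemainder_self] at this

/-- This is the differential inequality saying that the remainder divided by (y - x)^(N+1) is
antitone in x. The difference of the two sides vanishes at x = y, and its derivative is minus the
same difference for the shifted chain; the induction starts from `a 2` ≥ 0. -/
theorem remainder_le_mul (N : ℕ) : ∀ {a : ℕ → ℝ → ℝ}, IsCompletelyMonotoneChain a →
    ∀ {y x : ℝ}, 0 < x → x ≤ y →
      (N + 1) * chainRemainder a (N + 1) y x
        ≤ (y - x) * chainRemainder (fun n => a (n + 1)) N y x := by
  induction N with
  | zero =>
    intro a h y x hx hxy
    have hd : ∀ z > 0, HasDerivAt (fun z => (y - z) * a 1 z - chainRemainder a 1 y z)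
        (-((y - z) * a 2 z)) z := by
      intro z hz
      have h1 := (((hasDerivAt_id z).const_sub y).mul (h.hasDerivAt 1 z hz)).sub
        (h.hasDerivAt_remainder 0 (y := y) hz)
      refine h1.congr_deriv ?_
      simp [chainRemainder, chainTaylor]
    have hanti : AntitoneOn (fun z => (y - z) * a 1 z - chainRemainder a 1 y z) (Icc x y) := by
      refine antitoneOn_of_hasDerivWithinAt_nonpos (convex_Icc x y)
        (fun z hz => (hd z (hx.trans_le hz.1)).continuousAt.continuousWithinAt)
        (fun z hz => (hd z ?_).hasDerivWithinAt) fun z hz => ?_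
      · rw [interior_Icc] at hz; exact hx.trans hz.1
      · rw [interior_Icc] at hz
        exact neg_nonpos.2 (mul_nonneg (by linarith [hz.2]) (h.nonneg 2 z (hx.trans hz.1)))
    have := hanti ⟨le_rfl, hxy⟩ ⟨hxy, le_rfl⟩ hxy
    simp only [sub_self, zero_mul, chainRemainder_self] at this
    simp only [Nat.cast_zero, zero_add, one_mul]
    have h0 : chainRemainder (fun n => a (n + 1)) 0 y x = a 1 x := by
      simp [chainRemainder, chainTaylor]
    rw [h0]; linarith
  | succ N ih =>
    intro a h y x hx hxy
    set b : ℕ → ℝ → ℝ := fun n => a (n + 1) with hb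
    set b' : ℕ → ℝ → ℝ := fun n => b (n + 1) with hb'
    have hd : ∀ z > 0, HasDerivAt
        (fun z => (y - z) * chainRemainder b (N + 1) y z
          - (((N + 1 : ℕ) : ℝ) + 1) * chainRemainder a (N + 1 + 1) y z)
        (-((y - z) * chainRemainder b' N y z - (N + 1) * chainRemainder b (N + 1) y z)) z := by
      intro z hz
      have h1 := (((hasDerivAt_id z).const_sub y).mul (h.shift.hasDerivAt_remainder N (y := y) hz)).sub
        ((h.hasDerivAt_remainder (N + 1) (y := y) hz).const_mul (((N + 1 : ℕ) : ℝ) + 1))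
      refine h1.congr_deriv ?_
      simp only [id, ← hb]
      push_cast; ring
    have hanti : AntitoneOn (fun z => (y - z) * chainRemainder b (N + 1) y z
          - (((N + 1 : ℕ) : ℝ) + 1) * chainRemainder a (N + 1 + 1) y z) (Icc x y) := by
      refine antitoneOn_of_hasDerivWithinAt_nonpos (convex_Icc x y)
        (fun z hz => (hd z (hx.trans_le hz.1)).continuousAt.continuousWithinAt)
        (fun z hz => (hd z ?_).hasDerivWithinAt) fun z hz => ?_
      · rw [interior_Icc] at hz; exact hx.trans hz.1
      · rw [interior_Icc] at hz
        exact neg_nonpos.2 (sub_nonneg.2 (ih h.shift (hx.trans hz.1) hz.2.le))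
    have := hanti ⟨le_rfl, hxy⟩ ⟨hxy, le_rfl⟩ hxy
    simp only [sub_self, chainRemainder_self, mul_zero] at this
    linarith

theorem remainder_le_pow (h : IsCompletelyMonotoneChain a) (N : ℕ) {y x x' : ℝ} (hx' : 0 < x')
    (hxx : x' ≤ x) (hxy : x < y) :
    chainRemainder a (N + 1) y x ≤ ((y - x) / (y - x')) ^ (N + 1) * chainRemainder a (N + 1) y x' := by
  have hd : ∀ z ∈ Icc x' x, HasDerivAt (fun z => chainRemainder a (N + 1) y z / (y - z) ^ (N + 1))
      (((N + 1) * chainRemainder a (N + 1) y z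
        - (y - z) * chainRemainder (fun n => a (n + 1)) N y z) / (y - z) ^ (N + 2)) z := by
    intro z hz
    have hz0 : 0 < y - z := by linarith [hz.2]
    have h1 : HasDerivAt (fun z => (y - z) ^ (N + 1)) (((N : ℝ) + 1) * (y - z) ^ N * -1) z := by
      have := ((hasDerivAt_id z).const_sub y).fun_pow (N + 1)
      simpa using this
    refine ((h.hasDerivAt_remainder N (y := y) (hx'.trans_le hz.1)).div h1
      (by positivity)).congr_deriv ?_
    field_simp
    ring
  have hanti : AntitoneOn (fun z => chainRemainder a (N + 1) y z / (y - z) ^ (N + 1))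
      (Icc x' x) := by
    refine antitoneOn_of_hasDerivWithinAt_nonpos (convex_Icc x' x)
      (fun z hz => (hd z hz).continuousAt.continuousWithinAt)
      (fun z hz => (hd z (interior_subset hz)).hasDerivWithinAt) fun z hz => ?_
    have hz' := interior_subset hz
    have hz0 : 0 < y - z := by linarith [hz'.2]
    refine div_nonpos_of_nonpos_of_nonneg (sub_nonpos.2 ?_) (by positivity)
    exact remainder_le_mul N h (hx'.trans_le hz'.1) (by linarith)
  have h1 := hanti ⟨le_rfl, hxx⟩ ⟨hxx, le_rfl⟩ hxx
  have h2 : 0 < y - x := by linarith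
  have h3 : 0 < y - x' := by linarith
  simp only at h1
  rw [div_le_iff₀ (by positivity)] at h1
  rw [div_pow]
  calc _ ≤ _ := h1
    _ = _ := by ring

/-- Comparison with the point x/2 gives geometric decay; the remainder there is at most `a 0 (x /
2)` because all Taylor terms to the left of y are nonnegative. -/
theorem tendsto_remainder (h : IsCompletelyMonotoneChain a) {y x : ℝ} (hx : 0 < x) (hxy : x < y) :
    Tendsto (fun N => chainRemainder a (N + 1) y x) atTop (𝓝 0) := by
  have hr : (y - x) / (y - x / 2) < 1 := by rw [div_lt_one] <;> linarith
  have hr0 : 0 ≤ (y - x) / (y - x / 2) := div_nonneg (by linarith) (by linarith)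
  have hlim := ((tendsto_pow_atTop_nhds_zero_of_lt_one hr0 hr).comp
    (tendsto_add_atTop_nat 1)).mul_const (a 0 (x / 2))
  rw [zero_mul] at hlim
  refine squeeze_zero (fun N => remainder_nonneg _ h hx hxy.le) (fun N => ?_) hlim
  refine (h.remainder_le_pow N (half_pos hx) (by linarith) hxy).trans ?_
  refine mul_le_mul_of_nonneg_left ?_ (by positivity)
  rw [chainRemainder, sub_le_self_iff]
  refine Finset.sum_nonneg fun k _ => mul_nonneg (h.nonneg k y (by linarith)) ?_
  have : 0 ≤ y - x / 2 := by linarith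
  positivity

end IsCompletelyMonotoneChain

/-- The bound is uniform in k, which allows the powers (1 - x/y)^k of a Taylor polynomial at y to be
replaced by e^{-kx/y}. It follows from e^{-s}(1 - s²) ≤ 1 - s, Bernoulli's inequality and t e^{-t} ≤
1 with t = ks. -/
theorem abs_exp_sub_one_sub_pow_le {s : ℝ} (h0 : 0 ≤ s) (h1 : s ≤ 1) (k : ℕ) :
    |Real.exp (-(k * s)) - (1 - s) ^ k| ≤ s := by
  have hb : 0 ≤ 1 - s := by linarith
  have hexp : Real.exp (-(k * s)) = Real.exp (-s) ^ k := by
    rw [← Real.exp_nat_mul]; ring_nf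
  have hle : (1 - s) ^ k ≤ Real.exp (-s) ^ k := pow_le_pow_left₀ hb (Real.one_sub_le_exp_neg s) k
  have hbase : Real.exp (-s) * (1 - s ^ 2) ≤ 1 - s := by
    have h2 : Real.exp (-s) * (1 + s) ≤ 1 := by
      rw [Real.exp_neg, inv_mul_le_iff₀ (Real.exp_pos s), mul_one]
      linarith [Real.add_one_le_exp s]
    nlinarith
  have hs2 : 0 ≤ 1 - s ^ 2 := by nlinarith
  have hpow : Real.exp (-s) ^ k * (1 - k * s ^ 2) ≤ (1 - s) ^ k := by
    have h3 : 1 - k * s ^ 2 ≤ (1 - s ^ 2) ^ k := by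
      have := one_add_mul_le_pow (a := -s ^ 2) (by nlinarith) k
      have e : 1 + -s ^ 2 = 1 - s ^ 2 := by ring
      rw [e] at this
      linarith
    calc Real.exp (-s) ^ k * (1 - k * s ^ 2) ≤ Real.exp (-s) ^ k * (1 - s ^ 2) ^ k :=
          mul_le_mul_of_nonneg_left h3 (by positivity)
      _ = (Real.exp (-s) * (1 - s ^ 2)) ^ k := by rw [mul_pow]
      _ ≤ _ := pow_le_pow_left₀ (mul_nonneg (Real.exp_pos _).le hs2) hbase k
  have hks : (k * s) * Real.exp (-(k * s)) ≤ 1 := by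
    rw [Real.exp_neg, ← div_eq_mul_inv, div_le_one (Real.exp_pos _)]
    linarith [Real.add_one_le_exp (k * s)]
  rw [← hexp] at hpow hle
  rw [abs_of_nonneg (by linarith)]
  nlinarith

/-- A completely monotone function that is continuous at the origin is, uniformly on compact
subsets of `[0, ∞)`, a limit of finite sums of exponentials with nonnegative coefficients. -/
theorem IsCompletelyMonotoneChain.exists_exp_sum_near {a : ℕ → ℝ → ℝ}
    (h : IsCompletelyMonotoneChain a) (hc : Continuous (a 0)) {Y ε : ℝ} (hY : 0 < Y) (hε : 0 < ε) :
    ∃ (N : ℕ) (c t : Fin N → ℝ), (∀ i, 0 ≤ c i) ∧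
      ∀ x ∈ Icc 0 Y, |a 0 x - ∑ i, c i * Real.exp (-t i * x)| ≤ ε := by
  have hM : 0 ≤ a 0 0 :=
    ge_of_tendsto (hc.continuousAt.tendsto.mono_left nhdsWithin_le_nhds : Tendsto (a 0) (𝓝[>] 0) _)
      (by filter_upwards [self_mem_nhdsWithin] with x hx using h.nonneg 0 x hx)
  set M := a 0 0 with hMdef
  -- The expansion point is taken far to the right: replacing powers by exponentials costs at most M
  -- · Y/y.
  obtain ⟨y, hyY, hyM⟩ : ∃ y > Y, Y / y * M ≤ ε / 3 := by
    refine ⟨Y + 3 * Y * M / ε + 1, ?_, ?_⟩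
    · have : 0 ≤ 3 * Y * M / ε := by positivity
      linarith
    · have h1 : 0 ≤ 3 * Y * M / ε := by positivity
      rw [div_mul_eq_mul_div, div_le_iff₀ (by linarith)]
      have : ε / 3 * (3 * Y * M / ε) = Y * M := by field_simp
      nlinarith
  have hy : 0 < y := hY.trans hyY
  -- Remainders converge only at positive points. Continuity at 0 transfers the bound from x₁ to 0,
  -- and antitonicity then gives it on all of [0, y].
  obtain ⟨x₁, hx₁, hx₁y, hx₁m⟩ : ∃ x₁ > 0, x₁ < y ∧ M - a 0 x₁ ≤ ε / 3 := by
    have h1 : ∀ᶠ x in 𝓝[>] (0 : ℝ), M - ε / 3 < a 0 x :=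
      (hc.continuousAt.tendsto.mono_left nhdsWithin_le_nhds).eventually_const_lt (by linarith)
    have h2 : ∀ᶠ x in 𝓝[>] (0 : ℝ), x < y := nhdsWithin_le_nhds (Iio_mem_nhds hy)
    obtain ⟨x, ⟨hx1, hx2⟩, hx3⟩ := ((h1.and h2).and self_mem_nhdsWithin).exists
    exact ⟨x, hx3, hx2, by linarith⟩
  obtain ⟨n, hn⟩ := ((h.tendsto_remainder hx₁ hx₁y).eventually_le_const
    (by positivity : (0 : ℝ) < ε / 3)).exists
  set N := n + 1 with hN
  have hanti : AntitoneOn (chainRemainder a N y) (Icc 0 y) := by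
    refine antitoneOn_of_hasDerivWithinAt_nonpos
      (f' := fun z => -chainRemainder (fun n => a (n + 1)) n y z) (convex_Icc 0 y) ?_
      (fun z hz => (h.hasDerivAt_remainder n ?_).hasDerivWithinAt) fun z hz => ?_
    · refine (hc.sub ?_).continuousOn
      unfold chainTaylor
      fun_prop
    · rw [interior_Icc] at hz; exact hz.1
    · rw [interior_Icc] at hz
      exact neg_nonpos.2 (IsCompletelyMonotoneChain.remainder_nonneg n h.shift hz.1 hz.2.le)
  have hTanti : chainTaylor a N y x₁ ≤ chainTaylor a N y 0 := by
    refine Finset.sum_le_sum fun k _ => mul_le_mul_of_nonneg_left ?_ (h.nonneg k y hy)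
    refine div_le_div_of_nonneg_right (pow_le_pow_left₀ (by linarith) (by linarith) k)
      (by positivity)
  have hR0 : chainRemainder a N y 0 ≤ 2 * ε / 3 := by
    simp only [chainRemainder] at hn ⊢
    linarith
  have hR0' : chainTaylor a N y 0 ≤ M := by
    have := hanti ⟨le_rfl, hy.le⟩ ⟨hy.le, le_rfl⟩ hy.le
    rw [hN, chainRemainder_self] at this
    simp only [chainRemainder] at this
    linarith
  have hcoef : ∀ k x, a k y * ((y - x) ^ k / k.factorial)
      = a k y * (y ^ k / k.factorial) * (1 - x / y) ^ k := by
    intro k x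
    have : y - x = y * (1 - x / y) := by field_simp
    rw [this, mul_pow]; ring
  refine ⟨N, fun i => a i y * (y ^ (i : ℕ) / (i : ℕ).factorial), fun i => i / y, fun i => ?_,
    fun x hx => ?_⟩
  · exact mul_nonneg (h.nonneg _ y hy) (by positivity)
  · rw [Fin.sum_univ_eq_sum_range (fun k : ℕ => a k y * (y ^ k / k.factorial)
      * Real.exp (-(k / y) * x)) N]
    have hs0 : 0 ≤ x / y := div_nonneg hx.1 hy.le
    have hs1 : x / y ≤ 1 := (div_le_one hy).2 (by linarith [hx.2])
    have h1 : |chainTaylor a N y x - ∑ k ∈ Finset.range N, a k y * (y ^ k / k.factorial)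
        * Real.exp (-(k / y) * x)| ≤ ε / 3 := by
      rw [chainTaylor, ← Finset.sum_sub_distrib]
      refine (Finset.abs_sum_le_sum_abs _ _).trans ?_
      calc ∑ k ∈ Finset.range N, |a k y * ((y - x) ^ k / k.factorial)
            - a k y * (y ^ k / k.factorial) * Real.exp (-(k / y) * x)|
          ≤ ∑ k ∈ Finset.range N, a k y * (y ^ k / k.factorial) * (x / y) := by
            refine Finset.sum_le_sum fun k _ => ?_
            rw [hcoef, ← mul_sub, abs_mul, abs_sub_comm,
              abs_of_nonneg (mul_nonneg (h.nonneg k y hy) (by positivity))]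
            refine mul_le_mul_of_nonneg_left ?_ (mul_nonneg (h.nonneg k y hy) (by positivity))
            have := abs_exp_sub_one_sub_pow_le hs0 hs1 k
            have e : -((k : ℝ) / y) * x = -(k * (x / y)) := by ring
            rwa [e]
        _ = chainTaylor a N y 0 * (x / y) := by rw [chainTaylor, Finset.sum_mul]; simp
        _ ≤ M * (Y / y) := by
            refine mul_le_mul hR0' (div_le_div_of_nonneg_right hx.2 hy.le) hs0 hM
        _ ≤ ε / 3 := by linarith
    have h2 : |a 0 x - chainTaylor a N y x| ≤ 2 * ε / 3 := by
      have hxy : x ∈ Icc 0 y := ⟨hx.1, by linarith [hx.2]⟩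
      have h3 := hanti ⟨le_rfl, hy.le⟩ hxy hx.1
      have h4 := hanti hxy ⟨hy.le, le_rfl⟩ hxy.2
      rw [hN, chainRemainder_self] at h4
      change |chainRemainder a N y x| ≤ _
      rw [abs_of_nonneg h4]; linarith
    calc _ ≤ _ := abs_sub_le _ (chainTaylor a N y x) _
      _ ≤ _ := by linarith

/-! ### Volterra equations with exponential-sum kernels -/

/-- Entrywise form of the spectral resolution of `exp (x A)` for a real symmetric matrix `A`. -/
theorem exists_spectral_solution {n : Type} [Fintype n] [DecidableEq n] (A : Matrix n n ℝ)
    (hA : A.IsHermitian) (o : n) :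
    ∃ (l : n → ℝ) (v : n → n → ℝ),
      (∀ a, ∑ j, v j o * v j a = if a = o then 1 else 0) ∧
      ∀ a x, HasDerivAt (fun x => ∑ j, v j o * v j a * Real.exp (l j * x))
        (∑ b, A a b * ∑ j, v j o * v j b * Real.exp (l j * x)) x := by
  refine ⟨hA.eigenvalues, fun j a => hA.eigenvectorBasis j a, fun a => ?_, fun a x => ?_⟩
  · have h := hA.eigenvectorBasis.sum_inner_mul_inner (EuclideanSpace.single o (1 : ℝ))
      (EuclideanSpace.single a (1 : ℝ))
    simpa [EuclideanSpace.inner_single_left, EuclideanSpace.inner_single_right,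
      Pi.single_apply] using h
  · have hv : ∀ j, ∑ b, A a b * hA.eigenvectorBasis j b
        = hA.eigenvalues j * hA.eigenvectorBasis j a := by
      intro j
      have := congrFun (hA.mulVec_eigenvectorBasis j) a
      simpa [Matrix.mulVec, dotProduct] using this
    have hd : HasDerivAt (fun x => ∑ j, hA.eigenvectorBasis j o * hA.eigenvectorBasis j a
        * Real.exp (hA.eigenvalues j * x)) (∑ j, hA.eigenvectorBasis j o * hA.eigenvectorBasis j a
        * (Real.exp (hA.eigenvalues j * x) * hA.eigenvalues j)) x := by
      refine HasDerivAt.fun_sum fun j _ => HasDerivAt.const_mul _ ?_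
      simpa using ((hasDerivAt_id x).const_mul (hA.eigenvalues j)).exp
    refine hd.congr_deriv ?_
    simp_rw [Finset.mul_sum]
    rw [Finset.sum_comm]
    refine Finset.sum_congr rfl fun j _ => ?_
    calc _ = hA.eigenvectorBasis j o * Real.exp (hA.eigenvalues j * x)
          * (hA.eigenvalues j * hA.eigenvectorBasis j a) := by ring
      _ = _ := by rw [← hv, Finset.mul_sum]; exact Finset.sum_congr rfl fun b _ => by ring

/-- A finite sum of exponentials with nonnegative coefficients. -/
def IsExpSum (f : ℝ → ℝ) : Prop :=
  ∃ (N : ℕ) (w l : Fin N → ℝ), (∀ i, 0 ≤ w i) ∧ ∀ x, f x = ∑ i, w i * Real.exp (l i * x)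

theorem IsExpSum.of_fintype {ι : Type} [Fintype ι] {w l : ι → ℝ} (hw : ∀ i, 0 ≤ w i) :
    IsExpSum fun x => ∑ i, w i * Real.exp (l i * x) := by
  let e := Fintype.equivFin ι
  refine ⟨Fintype.card ι, w ∘ e.symm, l ∘ e.symm, fun i => hw _, fun x => ?_⟩
  exact (e.symm.sum_comp fun i => w i * Real.exp (l i * x)).symm

theorem IsExpSum.continuous {f : ℝ → ℝ} (hf : IsExpSum f) : Continuous f := by
  obtain ⟨N, w, l, -, h⟩ := hf
  rw [funext h]
  fun_prop

/-- Variation of constants; it eliminates the auxiliary coordinates of the linear system for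
exponential-sum kernels. -/
theorem eq_halfConv_exp {u r : ℝ → ℝ} {s t : ℝ} (hr : Continuous r) (hu0 : u 0 = 0)
    (hu : ∀ x, HasDerivAt u (s * r x - t * u x) x) (x : ℝ) :
    u x = s * halfConv (fun y => Real.exp (-t * y)) r x := by
  have h1 : ∀ y, HasDerivAt (fun y => Real.exp (t * y) * u y) (s * (Real.exp (t * y) * r y)) y := by
    intro y
    have he : HasDerivAt (fun y => Real.exp (t * y)) (Real.exp (t * y) * t) y := by
      simpa using ((hasDerivAt_id y).const_mul t).exp
    refine (he.mul (hu y)).congr_deriv ?_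
    ring
  have h2 := intervalIntegral.integral_eq_sub_of_hasDerivAt (a := 0) (b := x)
    (fun y _ => h1 y) ((by fun_prop : Continuous fun y => s * (Real.exp (t * y) * r y)).intervalIntegrable _ _)
  rw [hu0, mul_zero, sub_zero, intervalIntegral.integral_const_mul] at h2
  have h3 : halfConv (fun y => Real.exp (-t * y)) r x
      = Real.exp (-t * x) * ∫ y in (0 : ℝ)..x, Real.exp (t * y) * r y := by
    rw [halfConv_comm, halfConv, ← intervalIntegral.integral_const_mul]
    refine intervalIntegral.integral_congr fun y _ => ?_
    rw [← mul_assoc, ← Real.exp_add, mul_comm]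
    ring_nf
  rw [h3, mul_left_comm, h2, ← mul_assoc, ← Real.exp_add]
  simp

/-- The solution of `r' = -β r + m * r`, `r 0 = 1`, for a kernel `m` that is a finite sum of
exponentials with nonnegative coefficients, is again such a sum. -/
theorem exists_expSum_solution {N : ℕ} (c t : Fin N → ℝ) (hc : ∀ i, 0 ≤ c i) (β : ℝ) :
    ∃ r : ℝ → ℝ, IsExpSum r ∧ r 0 = 1 ∧ ∀ x, HasDerivAt r
      (-β * r x + halfConv (fun y => ∑ i, c i * Real.exp (-t i * y)) r x) x := by
  -- Arrow matrix: coordinate i solves uᵢ' = √cᵢ r - tᵢ uᵢ and feeds √cᵢ uᵢ back into r', producing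
  -- the kernel cᵢ e^{-tᵢx}. Splitting cᵢ as √cᵢ · √cᵢ makes A symmetric, so r = Σ vⱼ(`none`)²
  -- e^{λⱼx} has nonnegative weights.
  let A : Matrix (Option (Fin N)) (Option (Fin N)) ℝ := fun a b =>
    match a, b with
    | none, none => -β
    | none, some i => √(c i)
    | some i, none => √(c i)
    | some i, some j => if i = j then -t i else 0
  have hA : A.IsHermitian := by
    refine Matrix.IsHermitian.ext fun a b => ?_
    rcases a with _ | i <;> rcases b with _ | j <;> simp only [A, star_trivial]
    by_cases h : i = j
    · subst h; rfl
    · rw [if_neg h, if_neg (Ne.symm h)]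
  obtain ⟨l, v, hv, hd⟩ := exists_spectral_solution A hA none
  set u : Option (Fin N) → ℝ → ℝ := fun a x => ∑ j, v j none * v j a * Real.exp (l j * x) with hu
  have hr : IsExpSum (u none) := IsExpSum.of_fintype fun j => mul_self_nonneg _
  have hui : ∀ i x, u (some i) x = √(c i) * halfConv (fun y => Real.exp (-t i * y)) (u none) x := by
    intro i x
    refine eq_halfConv_exp hr.continuous ?_ (fun x => (hd (some i) x).congr_deriv ?_) x
    · simpa [hu] using hv (some i)
    · rw [Fintype.sum_option]
      simp [A, hu, ite_mul, sub_eq_add_neg]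
  refine ⟨u none, hr, by simpa [hu] using hv none, fun x => (hd none x).congr_deriv ?_⟩
  rw [Fintype.sum_option]
  have h1 : ∀ i, A none (some i) * ∑ j, v j none * v j (some i) * Real.exp (l j * x)
      = c i * halfConv (fun y => Real.exp (-t i * y)) (u none) x := by
    intro i
    change √(c i) * u (some i) x = _
    rw [hui, ← mul_assoc, Real.mul_self_sqrt (hc i)]
  have hcont := hr.continuous
  have h2 : halfConv (fun y => ∑ i, c i * Real.exp (-t i * y)) (u none) x
      = ∑ i, c i * halfConv (fun y => Real.exp (-t i * y)) (u none) x := by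
    simp only [halfConv]
    rw [← Finset.sum_congr rfl fun i _ => intervalIntegral.integral_const_mul (c i) _,
      ← intervalIntegral.integral_finsetSum]
    · refine intervalIntegral.integral_congr fun y _ => ?_
      simp only [Finset.sum_mul, mul_assoc]
    · intro i _
      exact (by fun_prop : Continuous fun y => c i * (Real.exp (-t i * y) * u none (x - y))).intervalIntegrable _ _
  rw [h2, Finset.sum_congr rfl fun i _ => h1 i]

/-! ### Stability of the Volterra equation and passage to the limit -/

/-- `r` is continuous and solves `r' = -β r + m * r` on `(0, ∞)`. -/
structure IsVolterraSolution (β : ℝ) (m r : ℝ → ℝ) : Prop where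
  continuous : Continuous r
  hasDerivAt : ∀ x > 0, HasDerivAt r (-β * r x + halfConv m r x) x

/-- On compact intervals the solution depends in a Lipschitz way on the kernel. -/
theorem IsVolterraSolution.stability {β : ℝ} {m r : ℝ → ℝ} (hm : Continuous m)
    (hr : IsVolterraSolution β m r) {Y : ℝ} (hY : 0 < Y) :
    ∃ C, 0 ≤ C ∧ ∀ ε, 0 ≤ ε → ε ≤ 1 → ∀ m₁ r₁ : ℝ → ℝ, Continuous m₁ →
      IsVolterraSolution β m₁ r₁ → r₁ 0 = r 0 → (∀ x ∈ Icc 0 Y, |m x - m₁ x| ≤ ε) →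
      ∀ x ∈ Icc 0 Y, |r x - r₁ x| ≤ C * ε := by
  obtain ⟨M, hM⟩ : ∃ M, ∀ x ∈ Icc 0 Y, |m x| ≤ M :=
    isCompact_Icc.exists_bound_of_continuousOn hm.continuousOn
  obtain ⟨R, hR⟩ : ∃ R, ∀ x ∈ Icc 0 Y, |r x| ≤ R :=
    isCompact_Icc.exists_bound_of_continuousOn hr.continuous.continuousOn
  have hM0 : 0 ≤ M := (abs_nonneg _).trans (hM 0 ⟨le_rfl, hY.le⟩)
  have hR0 : 0 ≤ R := (abs_nonneg _).trans (hR 0 ⟨le_rfl, hY.le⟩)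
  set B := |β| + (M + 1) * Y + 1 with hB
  have hB0 : 0 < B := by positivity
  refine ⟨2 * (R * Y * Y) * Real.exp (2 * B * Y), by positivity, ?_⟩
  intro ε hε0 hε1 m₁ r₁ hm₁ hr₁ h0 hmm
  set d : ℝ → ℝ := fun x => r x - r₁ x with hd
  have hdc : Continuous d := hr.continuous.sub hr₁.continuous
  -- The sup norm is weighted by e^{-2Bx}. Integrating B D e^{2By} up to x₀ then gives at most half
  -- of D e^{2Bx₀}, which is absorbed without Gronwall's inequality or a small interval.
  obtain ⟨x₀, hx₀, hmax⟩ := isCompact_Icc.exists_isMaxOn (s := Icc 0 Y) ⟨0, le_rfl, hY.le⟩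
    (f := fun x => Real.exp (-(2 * B) * x) * |d x|) (by fun_prop)
  set D := Real.exp (-(2 * B) * x₀) * |d x₀| with hD
  have hD0 : 0 ≤ D := by positivity
  have hdD : ∀ y ∈ Icc 0 Y, |d y| ≤ D * Real.exp (2 * B * y) := by
    intro y hy
    have h1 : Real.exp (-(2 * B) * y) * |d y| ≤ D := hmax hy
    have h2 : |d y| = Real.exp (-(2 * B) * y) * |d y| * Real.exp (2 * B * y) := by
      rw [mul_right_comm, ← Real.exp_add]; simp
    rw [h2]
    exact mul_le_mul_of_nonneg_right h1 (Real.exp_pos _).le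
  have hconv : ∀ y ∈ Icc 0 Y, |halfConv m r y - halfConv m₁ r₁ y|
      ≤ (M + 1) * Y * (D * Real.exp (2 * B * y)) + ε * R * Y := by
    intro y hy
    have h1 : halfConv m r y - halfConv m₁ r₁ y
        = ∫ t in (0 : ℝ)..y, (m₁ t * d (y - t) + (m t - m₁ t) * r (y - t)) := by
      rw [halfConv, halfConv, ← intervalIntegral.integral_sub]
      · refine intervalIntegral.integral_congr fun t _ => ?_
        simp only [hd]; ring
      · exact (hm.mul (hr.continuous.comp (by fun_prop))).intervalIntegrable _ _
      · exact (hm₁.mul (hr₁.continuous.comp (by fun_prop))).intervalIntegrable _ _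
    have h2 : ∀ t ∈ uIoc 0 y, ‖m₁ t * d (y - t) + (m t - m₁ t) * r (y - t)‖
        ≤ (M + 1) * (D * Real.exp (2 * B * y)) + ε * R := by
      intro t ht
      rw [uIoc_of_le hy.1] at ht
      have ht' : t ∈ Icc 0 Y := ⟨ht.1.le, ht.2.trans hy.2⟩
      have hyt : y - t ∈ Icc 0 Y := ⟨by linarith [ht.2], by linarith [ht.1, hy.2]⟩
      have hm1 : |m₁ t| ≤ M + 1 := by
        have e1 := hM t ht'
        have e2 := hmm t ht'
        have e3 : |m₁ t| ≤ |m t| + |m t - m₁ t| := by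
          have := abs_sub_abs_le_abs_sub (m₁ t) (m t)
          rw [abs_sub_comm] at this; linarith
        linarith
      have hd1 : |d (y - t)| ≤ D * Real.exp (2 * B * y) := by
        refine (hdD _ hyt).trans (mul_le_mul_of_nonneg_left (Real.exp_le_exp.2 ?_) hD0)
        have : 0 ≤ B * t := mul_nonneg hB0.le ht.1.le
        linarith
      rw [Real.norm_eq_abs]
      refine (abs_add_le _ _).trans ?_
      rw [abs_mul, abs_mul]
      exact add_le_add (mul_le_mul hm1 hd1 (abs_nonneg _) (by linarith))
        (mul_le_mul (hmm t ht') (hR _ hyt) (abs_nonneg _) hε0)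
    rw [h1]
    refine (intervalIntegral.norm_integral_le_of_norm_le_const h2).trans ?_
    rw [sub_zero, abs_of_nonneg hy.1]
    have h3 : 0 ≤ (M + 1) * (D * Real.exp (2 * B * y)) + ε * R := by positivity
    calc _ ≤ ((M + 1) * (D * Real.exp (2 * B * y)) + ε * R) * Y :=
          mul_le_mul_of_nonneg_left hy.2 h3
      _ = _ := by ring
  set d' : ℝ → ℝ := fun y => -β * d y + (halfConv m r y - halfConv m₁ r₁ y) with hd'
  have hd'c : Continuous d' := by
    have := continuous_halfConv hm hr.continuous
    have := continuous_halfConv hm₁ hr₁.continuous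
    fun_prop
  have hderiv : ∀ y ∈ Ioo 0 x₀, HasDerivAt d (d' y) y := by
    intro y hy
    refine ((hr.hasDerivAt y hy.1).sub (hr₁.hasDerivAt y hy.1)).congr_deriv ?_
    simp only [hd', hd]; ring
  have hint := intervalIntegral.integral_eq_sub_of_hasDerivAt_of_le hx₀.1 hdc.continuousOn hderiv
    (hd'c.intervalIntegrable _ _)
  have hd0 : d 0 = 0 := by simp [hd, h0]
  rw [hd0, sub_zero] at hint
  have hbound : |d x₀| ≤ ∫ y in (0 : ℝ)..x₀, (B * D * Real.exp (2 * B * y) + ε * R * Y) := by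
    rw [← hint]
    have hle : ∀ y ∈ Ioc 0 x₀, ‖d' y‖ ≤ B * D * Real.exp (2 * B * y) + ε * R * Y := by
      intro y hy
      have hy' : y ∈ Icc 0 Y := ⟨hy.1.le, hy.2.trans hx₀.2⟩
      have e1 := hconv y hy'
      have e2 := hdD y hy'
      have e3 : |β| * |d y| ≤ |β| * (D * Real.exp (2 * B * y)) :=
        mul_le_mul_of_nonneg_left e2 (abs_nonneg _)
      have e4 : 0 ≤ D * Real.exp (2 * B * y) := by positivity
      rw [Real.norm_eq_abs]
      refine (abs_add_le _ _).trans ?_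
      rw [abs_mul, abs_neg]
      rw [hB]
      linarith
    have hci : Continuous fun y => B * D * Real.exp (2 * B * y) + ε * R * Y := by fun_prop
    exact intervalIntegral.norm_integral_le_of_norm_le hx₀.1 (ae_of_all _ hle)
      (hci.intervalIntegrable _ _)
  have hval : ∫ y in (0 : ℝ)..x₀, (B * D * Real.exp (2 * B * y) + ε * R * Y)
      = D / 2 * Real.exp (2 * B * x₀) + ε * R * Y * x₀ - D / 2 := by
    have hder : ∀ y ∈ uIcc 0 x₀, HasDerivAt
        (fun y => D / 2 * Real.exp (2 * B * y) + ε * R * Y * y)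
        (B * D * Real.exp (2 * B * y) + ε * R * Y) y := by
      intro y _
      have e1 : HasDerivAt (fun y => Real.exp (2 * B * y)) (Real.exp (2 * B * y) * (2 * B)) y := by
        simpa using ((hasDerivAt_id y).const_mul (2 * B)).exp
      refine ((e1.const_mul (D / 2)).add ((hasDerivAt_id y).const_mul (ε * R * Y))).congr_deriv ?_
      ring
    rw [intervalIntegral.integral_eq_sub_of_hasDerivAt hder
      ((by fun_prop : Continuous fun y => B * D * Real.exp (2 * B * y) + ε * R * Y).intervalIntegrable _ _)]
    simp
  have hexp0 : |d x₀| = D * Real.exp (2 * B * x₀) := by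
    rw [hD, mul_right_comm, ← Real.exp_add]; simp
  have hERY : 0 ≤ ε * R * Y := by positivity
  have hE : ε * R * Y * x₀ ≤ ε * R * Y * Y := mul_le_mul_of_nonneg_left hx₀.2 hERY
  have hDle : D ≤ 2 * (R * Y * Y) * ε := by
    have e1 : 1 ≤ Real.exp (2 * B * x₀) :=
      Real.one_le_exp (mul_nonneg (by positivity) hx₀.1)
    rw [hval, hexp0] at hbound
    nlinarith
  intro x hx
  calc |r x - r₁ x| ≤ D * Real.exp (2 * B * x) := hdD x hx
    _ ≤ 2 * (R * Y * Y) * ε * Real.exp (2 * B * Y) := by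
        refine mul_le_mul hDle (Real.exp_le_exp.2 ?_) (Real.exp_pos _).le (by positivity)
        exact mul_le_mul_of_nonneg_left hx.2 (by positivity)
    _ = _ := by ring

/-- For a completely monotone kernel the solution is a pointwise limit of finite sums of
exponentials with nonnegative coefficients. -/
theorem IsVolterraSolution.exists_tendsto_expSum {β : ℝ} {a : ℕ → ℝ → ℝ} {r : ℝ → ℝ}
    (ha : IsCompletelyMonotoneChain a) (hc : Continuous (a 0))
    (hr : IsVolterraSolution β (a 0) r) (hr0 : r 0 = 1) :
    ∃ e : ℕ → ℝ → ℝ, (∀ n, IsExpSum (e n)) ∧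
      ∀ x ≥ 0, Tendsto (fun n => e n x) atTop (𝓝 (r x)) := by
  have key : ∀ n : ℕ, ∃ f : ℝ → ℝ, IsExpSum f ∧
      ∀ x ∈ Icc (0 : ℝ) (n + 1), |r x - f x| ≤ 1 / ((n : ℝ) + 1) := by
    intro n
    have hY : (0 : ℝ) < n + 1 := by positivity
    obtain ⟨C, hC0, hC⟩ := hr.stability hc hY
    -- Chosen so that Cε ≤ 1/(n + 1); taking C + 1 covers C = 0 and also ensures ε ≤ 1.
    set ε : ℝ := 1 / ((C + 1) * (n + 1)) with hε
    have hε0 : 0 < ε := by positivity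
    have hε1 : ε ≤ 1 := by
      rw [hε, div_le_one (by positivity)]
      have : (0 : ℝ) ≤ n := n.cast_nonneg
      nlinarith [mul_nonneg hC0 this]
    obtain ⟨N, c, t, hc0, hct⟩ := ha.exists_exp_sum_near hc hY hε0
    obtain ⟨f, hf, hf0, hfd⟩ := exists_expSum_solution c t hc0 β
    refine ⟨f, hf, fun x hx => ?_⟩
    refine (hC ε hε0.le hε1 _ f (by fun_prop) ⟨hf.continuous, fun x _ => hfd x⟩
      (by rw [hf0, hr0]) hct x hx).trans ?_
    rw [hε, mul_one_div, div_le_div_iff₀ (by positivity) hY]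
    nlinarith
  choose e he hb using key
  refine ⟨e, he, fun x hx => ?_⟩
  rw [tendsto_iff_norm_sub_tendsto_zero]
  refine squeeze_zero' (Eventually.of_forall fun _ => norm_nonneg _) ?_
    tendsto_one_div_add_atTop_nhds_zero_nat
  obtain ⟨n₀, hn₀⟩ := exists_nat_ge x
  filter_upwards [eventually_ge_atTop n₀] with n hn
  rw [Real.norm_eq_abs, abs_sub_comm]
  refine hb n x ⟨hx, ?_⟩
  have : (n₀ : ℝ) ≤ n := by exact_mod_cast hn
  linarith

/-! ### Log-convexity of the second derivative -/

/-- The weighted second difference of a sum of exponentials is convex. -/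
theorem IsExpSum.convexOn_second_difference {f : ℝ → ℝ} (hf : IsExpSum f) (α h : ℝ) :
    ConvexOn ℝ univ fun x => Real.exp (α * x) * (f x - 2 * f (x + h) + f (x + 2 * h)) := by
  obtain ⟨N, w, l, hw, hfe⟩ := hf
  -- The second difference multiplies each weight by the square (1 - e^{lh})², and the factor e^{αx}
  -- shifts each rate, so the result is again an exponential sum with nonnegative weights.
  have heq : (fun x => Real.exp (α * x) * (f x - 2 * f (x + h) + f (x + 2 * h)))
      = fun x => ∑ i, w i * (1 - Real.exp (l i * h)) ^ 2 * Real.exp ((α + l i) * x) := by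
    ext x
    rw [hfe, hfe, hfe, Finset.mul_sum, ← Finset.sum_sub_distrib, ← Finset.sum_add_distrib,
      Finset.mul_sum]
    refine Finset.sum_congr rfl fun i _ => ?_
    have e₁ : Real.exp (l i * (x + h)) = Real.exp (l i * x) * Real.exp (l i * h) := by
      rw [← Real.exp_add]; ring_nf
    have e₂ : Real.exp (l i * (x + 2 * h)) = Real.exp (l i * x) * Real.exp (l i * h) ^ 2 := by
      rw [← Real.exp_nat_mul, ← Real.exp_add]; push_cast; ring_nf
    have e₃ : Real.exp ((α + l i) * x) = Real.exp (α * x) * Real.exp (l i * x) := by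
      rw [← Real.exp_add]; ring_nf
    rw [e₁, e₂, e₃]
    ring
  rw [heq]
  refine ⟨convex_univ, fun x _ y _ a b ha hb hab => ?_⟩
  simp only [smul_eq_mul, Finset.mul_sum, ← Finset.sum_add_distrib]
  refine Finset.sum_le_sum fun i _ => ?_
  have := convexOn_exp.2 (mem_univ ((α + l i) * x)) (mem_univ ((α + l i) * y)) ha hb hab
  simp only [smul_eq_mul] at this
  calc w i * (1 - Real.exp (l i * h)) ^ 2 * Real.exp ((α + l i) * (a * x + b * y))
      = w i * (1 - Real.exp (l i * h)) ^ 2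
        * Real.exp (a * ((α + l i) * x) + b * ((α + l i) * y)) := by ring_nf
    _ ≤ w i * (1 - Real.exp (l i * h)) ^ 2
        * (a * Real.exp ((α + l i) * x) + b * Real.exp ((α + l i) * y)) :=
        mul_le_mul_of_nonneg_left this (mul_nonneg (hw i) (sq_nonneg _))
    _ = _ := by ring

/-- Second differences stand in for second derivatives because they pass to pointwise limits. -/
theorem IsExpSum.second_difference_nonneg {f : ℝ → ℝ} (hf : IsExpSum f) (h x : ℝ) :
    0 ≤ f x - 2 * f (x + h) + f (x + 2 * h) := by
  obtain ⟨N, w, l, hw, hfe⟩ := hf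
  rw [hfe, hfe, hfe, Finset.mul_sum, ← Finset.sum_sub_distrib, ← Finset.sum_add_distrib]
  refine Finset.sum_nonneg fun i _ => ?_
  have : w i * Real.exp (l i * x) - 2 * (w i * Real.exp (l i * (x + h)))
      + w i * Real.exp (l i * (x + 2 * h))
      = w i * ((1 - Real.exp (l i * h)) ^ 2 * Real.exp (l i * x)) := by
    rw [mul_add, mul_add, Real.exp_add, Real.exp_add,
      show l i * (2 * h) = l i * h + l i * h by ring, Real.exp_add]
    ring
  rw [this]
  exact mul_nonneg (hw i) (by positivity)

theorem convexOn_of_tendsto {s : Set ℝ} {F : ℕ → ℝ → ℝ} {f : ℝ → ℝ}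
    (hF : ∀ n, ConvexOn ℝ s (F n)) (hlim : ∀ x ∈ s, Tendsto (fun n => F n x) atTop (𝓝 (f x))) :
    ConvexOn ℝ s f := by
  refine ⟨(hF 0).1, fun x hx y hy a b ha hb hab => ?_⟩
  refine le_of_tendsto_of_tendsto' (hlim _ ((hF 0).1 hx hy ha hb hab))
    (((hlim x hx).const_smul a).add ((hlim y hy).const_smul b)) fun n => ?_
  exact (hF n).2 hx hy ha hb hab

/-- The second difference of step `h` divided by `h ^ 2` converges to the second derivative. -/
theorem tendsto_second_difference {r r₁ r₂ : ℝ → ℝ} {x : ℝ} (hx : 0 < x)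
    (h₁ : ∀ x > 0, HasDerivAt r (r₁ x) x) (h₂ : ∀ x > 0, HasDerivAt r₁ (r₂ x) x)
    (hc : Continuous r₂) :
    Tendsto (fun n : ℕ => ((n : ℝ) + 1) ^ 2 * (r x - 2 * r (x + 1 / ((n : ℝ) + 1))
      + r (x + 2 * (1 / ((n : ℝ) + 1))))) atTop (𝓝 (r₂ x)) := by
  have key : ∀ h > 0, ∃ ξ ∈ Icc x (x + 2 * h), r x - 2 * r (x + h) + r (x + 2 * h)
      = h ^ 2 * r₂ ξ := by
    intro h hh
    have hd : ∀ u > 0, HasDerivAt (fun u => r (u + h) - r u) (r₁ (u + h) - r₁ u) u := fun u hu =>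
      ((h₁ (u + h) (by linarith)).comp_add_const u h).sub (h₁ u hu)
    obtain ⟨ξ₁, hξ₁, e₁⟩ := exists_hasDerivAt_eq_slope (fun u => r (u + h) - r u)
      (fun u => r₁ (u + h) - r₁ u) (by linarith : x < x + h)
      (fun u hu => (hd u (hx.trans_le hu.1)).continuousAt.continuousWithinAt)
      (fun u hu => hd u (hx.trans hu.1))
    have hξ0 : 0 < ξ₁ := hx.trans hξ₁.1
    obtain ⟨ξ₂, hξ₂, e₂⟩ := exists_hasDerivAt_eq_slope r₁ r₂ (by linarith : ξ₁ < ξ₁ + h)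
      (fun u hu => (h₂ u (hξ0.trans_le hu.1)).continuousAt.continuousWithinAt)
      (fun u hu => h₂ u (hξ0.trans hu.1))
    refine ⟨ξ₂, ⟨by linarith [hξ₁.1, hξ₂.1], by linarith [hξ₁.2, hξ₂.2]⟩, ?_⟩
    rw [add_sub_cancel_left, eq_div_iff hh.ne'] at e₁ e₂
    have e₃ : x + h + h = x + 2 * h := by ring
    rw [e₃] at e₁
    rw [pow_two, mul_assoc, mul_comm h (r₂ ξ₂), e₂]
    linear_combination -e₁
  choose! ξ hξ hξe using fun n : ℕ => key (1 / ((n : ℝ) + 1)) (by positivity)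
  have hlim : Tendsto ξ atTop (𝓝 x) := by
    refine tendsto_of_tendsto_of_tendsto_of_le_of_le tendsto_const_nhds ?_ (fun n => (hξ n).1)
      (fun n => (hξ n).2)
    have := (tendsto_one_div_add_atTop_nhds_zero_nat (𝕜 := ℝ)).const_mul 2 |>.const_add x
    simpa using this
  refine ((hc.tendsto x).comp hlim).congr fun n => ?_
  have : (n : ℝ) + 1 ≠ 0 := by positivity
  rw [hξe, Function.comp]
  field_simp


/-- The second derivative of a limit of sums of exponentials is nonnegative and log-convex; the
latter is expressed by the convexity of `e^{αx} r''(x)` for every `α`. -/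
theorem second_deriv_of_tendsto_expSum {r r₁ r₂ : ℝ → ℝ} {e : ℕ → ℝ → ℝ}
    (he : ∀ n, IsExpSum (e n)) (hlim : ∀ x ≥ 0, Tendsto (fun n => e n x) atTop (𝓝 (r x)))
    (h₁ : ∀ x > 0, HasDerivAt r (r₁ x) x) (h₂ : ∀ x > 0, HasDerivAt r₁ (r₂ x) x)
    (hc : Continuous r₂) :
    (∀ x > 0, 0 ≤ r₂ x) ∧ ∀ α : ℝ, ConvexOn ℝ (Ioi 0) fun x => Real.exp (α * x) * r₂ x := by
  have hdiff : ∀ h ≥ 0, ∀ x ≥ 0, Tendsto (fun n => e n x - 2 * e n (x + h) + e n (x + 2 * h)) atTop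
      (𝓝 (r x - 2 * r (x + h) + r (x + 2 * h))) := fun h hh x hx =>
    ((hlim x hx).sub ((hlim (x + h) (by linarith)).const_mul 2)).add
      (hlim (x + 2 * h) (by linarith))
  have hinv : ∀ n : ℕ, (0 : ℝ) ≤ 1 / ((n : ℝ) + 1) := fun n => by positivity
  refine ⟨fun x hx => ?_, fun α => ?_⟩
  · refine ge_of_tendsto' (tendsto_second_difference hx h₁ h₂ hc) fun n => ?_
    refine mul_nonneg (by positivity) ?_
    exact ge_of_tendsto' (hdiff _ (hinv n) x hx.le) fun k => (he k).second_difference_nonneg _ _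
  · refine convexOn_of_tendsto (F := fun n x => Real.exp (α * x) *
      (((n : ℝ) + 1) ^ 2 * (r x - 2 * r (x + 1 / ((n : ℝ) + 1))
      + r (x + 2 * (1 / ((n : ℝ) + 1)))))) (fun n => ?_)
      fun x hx => (tendsto_second_difference hx h₁ h₂ hc).const_mul _
    have h3 : ConvexOn ℝ (Ioi 0) fun x => Real.exp (α * x) *
        (r x - 2 * r (x + 1 / ((n : ℝ) + 1)) + r (x + 2 * (1 / ((n : ℝ) + 1)))) :=
      convexOn_of_tendsto
        (fun k => ((he k).convexOn_second_difference α _).subset (subset_univ _) (convex_Ioi 0))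
        fun x hx => (hdiff _ (hinv n) x (le_of_lt hx)).const_mul _
    refine (h3.smul (by positivity : (0 : ℝ) ≤ ((n : ℝ) + 1) ^ 2)).congr fun x _ => ?_
    simp only [smul_eq_mul]; ring

/-- If `e^{αx} p(x)` is convex for every `α` and `p ≥ 0` vanishes at one point, then `p` is zero. -/
theorem eq_zero_of_convexOn_exp_mul {p : ℝ → ℝ} (hp : ∀ x > 0, 0 ≤ p x)
    (hconv : ∀ α : ℝ, ConvexOn ℝ (Ioi 0) fun x => Real.exp (α * x) * p x) {x₀ : ℝ} (hx₀ : 0 < x₀)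
    (h0 : p x₀ = 0) : ∀ x > 0, p x = 0 := by
  intro x hx
  rcases eq_or_ne x x₀ with rfl | hne
  · exact h0
  -- The point y lies beyond x, on the side away from x₀, and this t keeps y positive. Convexity
  -- between y and x₀ bounds p(x) by e^{α(y-x)} p(y)/(1 + t), and α is then chosen so that α(y - x)
  -- → -∞.
  set t := x / (2 * x₀) with ht
  have ht0 : 0 < t := by positivity
  set y := x + t * (x - x₀) with hy
  have hy0 : 0 < y := by
    have : y = x / 2 + t * x := by rw [hy, ht]; field_simp; ring
    rw [this]; positivity
  have hyx : y - x ≠ 0 := by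
    rw [hy, add_sub_cancel_left]
    exact mul_ne_zero ht0.ne' (sub_ne_zero.2 hne)
  have hb : ∀ α : ℝ, p x ≤ Real.exp (α * (y - x)) * (1 / (1 + t) * p y) := by
    intro α
    have h := (hconv α).2 (mem_Ioi.2 hy0) (mem_Ioi.2 hx₀) (by positivity : 0 ≤ 1 / (1 + t))
      (by positivity : 0 ≤ t / (1 + t)) (by field_simp)
    simp only [smul_eq_mul, h0, mul_zero, add_zero] at h
    rw [show 1 / (1 + t) * y + t / (1 + t) * x₀ = x by rw [hy]; field_simp; ring] at h
    have e : Real.exp (α * (y - x)) = Real.exp (α * y) / Real.exp (α * x) := by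
      rw [← Real.exp_sub]; ring_nf
    rw [e, div_mul_eq_mul_div, le_div_iff₀ (Real.exp_pos _)]
    linarith
  have hlim : Tendsto (fun n : ℕ => Real.exp (-(n : ℝ)) * (1 / (1 + t) * p y)) atTop (𝓝 0) := by
    have := (Real.tendsto_exp_neg_atTop_nhds_zero.comp
      tendsto_natCast_atTop_atTop).mul_const (1 / (1 + t) * p y)
    simpa using this
  refine le_antisymm (ge_of_tendsto' hlim fun n => ?_) (hp x hx)
  have := hb (-(n : ℝ) / (y - x))
  rwa [div_mul_cancel₀ _ hyx] at this

/-- A positive function `p` for which all `e^{αx} p(x)` are convex has monotone `p' / p`. -/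
theorem deriv_ge_of_convexOn_exp_mul {p p' : ℝ → ℝ} (hp' : ∀ x > 0, HasDerivAt p (p' x) x)
    (hconv : ∀ α : ℝ, ConvexOn ℝ (Ioi 0) fun x => Real.exp (α * x) * p x) {L x y : ℝ}
    (hx : 0 < x) (hxy : x ≤ y) (hL : p' x = L * p x) : L * p y ≤ p' y := by
  rcases hxy.eq_or_lt with rfl | hlt
  · exact hL.ge
  -- With α = -L the tilted function has zero derivative at x, and convexity keeps its derivative
  -- nonnegative to the right.
  have hd : ∀ z > 0, HasDerivAt (fun z => Real.exp (-L * z) * p z)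
      (Real.exp (-L * z) * (p' z - L * p z)) z := by
    intro z hz
    have he : HasDerivAt (fun z => Real.exp (-L * z)) (Real.exp (-L * z) * -L) z := by
      simpa using ((hasDerivAt_id z).const_mul (-L)).exp
    refine (he.mul (hp' z hz)).congr_deriv ?_
    ring
  have hy := hx.trans hlt
  have h1 := (hconv (-L)).le_slope_of_hasDerivAt hx hy hlt (hd x hx)
  have h2 := (hconv (-L)).slope_le_of_hasDerivAt hx hy hlt (hd y hy)
  have h3 := h1.trans h2
  rw [hL, sub_self, mul_zero] at h3
  have := nonneg_of_mul_nonneg_right h3 (Real.exp_pos _)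
  linarith

/-! ### The reduced scale function: signs of r, r', r'' and growth of U -/

/-- The data to which the scale function reduces: `U` is a multiple of the scale function,
`r = U' - Φ U`, and `a 0` is the kernel of the Volterra equation of `r`. -/
structure IsReducedScale (Φ β : ℝ) (a : ℕ → ℝ → ℝ) (r U : ℝ → ℝ) : Prop where
  Φ_pos : 0 < Φ
  Φ_lt : Φ < β
  chain : IsCompletelyMonotoneChain a
  kernel_continuous : Continuous (a 0)
  volterra : IsVolterraSolution β (a 0) r
  r_zero : r 0 = 1
  mass_le : ∀ x ≥ 0, ∫ t in (0 : ℝ)..x, a 0 t ≤ β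
  continuous : Continuous U
  U_zero : U 0 = 0
  strictMonoOn : StrictMonoOn U (Ici 0)
  hasDerivAt : ∀ x > 0, HasDerivAt U (r x + Φ * U x) x


namespace IsReducedScale

/-- `r'`. -/
def resolvent₁ (β : ℝ) (m r : ℝ → ℝ) (x : ℝ) : ℝ := -β * r x + halfConv m r x

/-- `r''`. -/
def resolvent₂ (β : ℝ) (m r : ℝ → ℝ) (x : ℝ) : ℝ :=
  -β * resolvent₁ β m r x + (m x * r 0 + halfConv m (resolvent₁ β m r) x)

variable {Φ β : ℝ} {a : ℕ → ℝ → ℝ} {r U : ℝ → ℝ}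

theorem continuous₁ (h : IsReducedScale Φ β a r U) : Continuous (resolvent₁ β (a 0) r) :=
  (h.volterra.continuous.const_mul _).add
    (continuous_halfConv h.kernel_continuous h.volterra.continuous)

theorem continuous₂ (h : IsReducedScale Φ β a r U) : Continuous (resolvent₂ β (a 0) r) :=
  (h.continuous₁.const_mul _).add ((h.kernel_continuous.mul continuous_const).add
    (continuous_halfConv h.kernel_continuous h.continuous₁))

theorem hasDerivAt₀ (h : IsReducedScale Φ β a r U) :
    ∀ x > 0, HasDerivAt r (resolvent₁ β (a 0) r x) x := h.volterra.hasDerivAt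

theorem hasDerivAt₁ (h : IsReducedScale Φ β a r U) :
    ∀ x > 0, HasDerivAt (resolvent₁ β (a 0) r) (resolvent₂ β (a 0) r x) x := fun x hx =>
  ((h.hasDerivAt₀ x hx).const_mul _).add
    (hasDerivAt_halfConv h.kernel_continuous h.volterra.continuous h.continuous₁ h.hasDerivAt₀ hx)

theorem exists_hasDerivAt₂ (h : IsReducedScale Φ β a r U) :
    ∃ r₃ : ℝ → ℝ, ∀ x > 0, HasDerivAt (resolvent₂ β (a 0) r) (r₃ x) x :=
  ⟨_, fun x hx => ((h.hasDerivAt₁ x hx).const_mul (-β)).add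
    (((h.chain.hasDerivAt 0 x hx).mul_const (r 0)).add
    (hasDerivAt_halfConv h.kernel_continuous h.continuous₁ h.continuous₂ h.hasDerivAt₁ hx))⟩

theorem resolvent₁_zero (h : IsReducedScale Φ β a r U) : resolvent₁ β (a 0) r 0 = -β := by
  simp [resolvent₁, halfConv_zero, h.r_zero]

theorem resolvent₂_zero (h : IsReducedScale Φ β a r U) :
    resolvent₂ β (a 0) r 0 = β ^ 2 + a 0 0 := by
  simp only [resolvent₂, halfConv_zero, h.r_zero, h.resolvent₁_zero]; ring

theorem kernel_zero_nonneg (h : IsReducedScale Φ β a r U) : 0 ≤ a 0 0 :=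
  ge_of_tendsto (h.kernel_continuous.continuousAt.tendsto.mono_left nhdsWithin_le_nhds :
    Tendsto (a 0) (𝓝[>] 0) _)
    (by filter_upwards [self_mem_nhdsWithin] with x hx using h.chain.nonneg 0 x hx)

theorem r_nonneg (h : IsReducedScale Φ β a r U) : ∀ x ≥ 0, 0 ≤ r x := by
  obtain ⟨e, he, hlim⟩ := h.volterra.exists_tendsto_expSum h.chain h.kernel_continuous h.r_zero
  intro x hx
  refine ge_of_tendsto' (hlim x hx) fun n => ?_
  obtain ⟨N, w, l, hw, hf⟩ := he n
  rw [hf]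
  exact Finset.sum_nonneg fun i _ => mul_nonneg (hw i) (Real.exp_pos _).le

theorem convexOn_exp_mul (h : IsReducedScale Φ β a r U) (α : ℝ) :
    ConvexOn ℝ (Ioi 0) fun x => Real.exp (α * x) * resolvent₂ β (a 0) r x := by
  obtain ⟨e, he, hlim⟩ := h.volterra.exists_tendsto_expSum h.chain h.kernel_continuous h.r_zero
  exact (second_deriv_of_tendsto_expSum he hlim h.hasDerivAt₀ h.hasDerivAt₁ h.continuous₂).2 α

/-- By log-convexity a single zero would force r'' to vanish on (0, ∞), and by continuity at 0 as
well, where r'' equals β² + `a 0 0` > 0. -/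
theorem resolvent₂_pos (h : IsReducedScale Φ β a r U) : ∀ x > 0, 0 < resolvent₂ β (a 0) r x := by
  obtain ⟨e, he, hlim⟩ := h.volterra.exists_tendsto_expSum h.chain h.kernel_continuous h.r_zero
  have h0 := (second_deriv_of_tendsto_expSum he hlim h.hasDerivAt₀ h.hasDerivAt₁ h.continuous₂).1
  intro x hx
  refine (h0 x hx).lt_of_ne fun hz => ?_
  have hall := eq_zero_of_convexOn_exp_mul h0 h.convexOn_exp_mul hx hz.symm
  have hcl : EqOn (resolvent₂ β (a 0) r) 0 (closure (Ioi 0)) :=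
    EqOn.closure (fun y hy => hall y hy) h.continuous₂ continuous_zero
  rw [closure_Ioi] at hcl
  have := hcl (mem_Ici.2 le_rfl)
  rw [h.resolvent₂_zero, Pi.zero_apply] at this
  have := h.kernel_zero_nonneg
  have := h.Φ_pos.trans h.Φ_lt
  nlinarith

theorem strictMonoOn_resolvent₁ (h : IsReducedScale Φ β a r U) :
    StrictMonoOn (resolvent₁ β (a 0) r) (Ici 0) :=
  strictMonoOn_of_hasDerivWithinAt_pos (convex_Ici 0) h.continuous₁.continuousOn
    (fun x hx => (h.hasDerivAt₁ x (by rwa [interior_Ici] at hx)).hasDerivWithinAt)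
    (fun x hx => h.resolvent₂_pos x (by rwa [interior_Ici] at hx))

/-- If r' were positive somewhere, convexity would make r grow at least linearly, and r would attain
its maximum over some [0, x] at x. There the convolution is at most the mass of the kernel times
r(x), hence at most β r(x), which forces r'(x) ≤ 0. -/
theorem resolvent₁_nonpos (h : IsReducedScale Φ β a r U) :
    ∀ x ≥ 0, resolvent₁ β (a 0) r x ≤ 0 := by
  intro x₀ hx₀
  by_contra! hpos
  set v := resolvent₁ β (a 0) r x₀ with hv
  have hge : ∀ x ≥ x₀, v ≤ resolvent₁ β (a 0) r x := fun x hx =>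
    h.strictMonoOn_resolvent₁.monotoneOn hx₀ (mem_Ici.2 (hx₀.le.trans hx)) hx
  have hlin : MonotoneOn (fun x => r x - v * x) (Ici x₀) := by
    refine monotoneOn_of_hasDerivWithinAt_nonneg (convex_Ici x₀)
      (h.volterra.continuous.sub (by fun_prop)).continuousOn
      (fun x hx => ((h.hasDerivAt₀ x ?_).sub ((hasDerivAt_id x).const_mul v)).hasDerivWithinAt)
      fun x hx => ?_
    · rw [interior_Ici] at hx; exact lt_of_le_of_lt hx₀ hx
    · rw [interior_Ici] at hx
      have := hge x (le_of_lt hx)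
      linarith
  have hmono : MonotoneOn r (Ici x₀) := by
    intro x hx y hy hxy
    have := hlin hx hy hxy
    simp only at this
    nlinarith
  obtain ⟨R, hR⟩ : ∃ R, ∀ x ∈ Icc 0 x₀, |r x| ≤ R :=
    isCompact_Icc.exists_bound_of_continuousOn h.volterra.continuous.continuousOn
  -- From r(x₀) ≥ -R and slope at least v this gives r(x) ≥ R, so r(x) dominates r on [0, x₀].
  set x := x₀ + 2 * R / v with hx
  have hR0 : 0 ≤ R := (abs_nonneg _).trans (hR 0 ⟨le_rfl, hx₀⟩)
  have hxx₀ : x₀ ≤ x := by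
    have : 0 ≤ 2 * R / v := by positivity
    linarith
  have hrx : R ≤ r x := by
    have h1 := hlin (mem_Ici.2 le_rfl) (mem_Ici.2 hxx₀) hxx₀
    have h2 := hR x₀ ⟨hx₀, le_rfl⟩
    have h3 : v * x = v * x₀ + 2 * R := by rw [hx]; field_simp
    simp only at h1
    rw [abs_le] at h2
    linarith [h2.1]
  have hmax : ∀ y ∈ Icc 0 x, r y ≤ r x := by
    intro y hy
    rcases le_total y x₀ with hyx | hyx
    · exact (le_abs_self _).trans ((hR y ⟨hy.1, hyx⟩).trans hrx)
    · exact hmono hyx hxx₀ hy.2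
  have hx0 : 0 ≤ x := le_trans hx₀ hxx₀
  have hconv : halfConv (a 0) r x ≤ β * r x := by
    have hm : ∀ t ≥ 0, 0 ≤ a 0 t := fun t ht => by
      rcases ht.lt_or_eq with ht | ht
      · exact h.chain.nonneg 0 t ht
      · rw [← ht]; exact h.kernel_zero_nonneg
    calc halfConv (a 0) r x ≤ ∫ t in (0 : ℝ)..x, a 0 t * r x := by
          refine intervalIntegral.integral_mono_on hx0
            ((h.kernel_continuous.mul (h.volterra.continuous.comp (by fun_prop))).intervalIntegrable _ _)
            ((h.kernel_continuous.mul continuous_const).intervalIntegrable _ _) fun t ht => ?_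
          exact mul_le_mul_of_nonneg_left (hmax _ ⟨by linarith [ht.2], by linarith [ht.1]⟩)
            (hm t ht.1)
      _ = (∫ t in (0 : ℝ)..x, a 0 t) * r x := intervalIntegral.integral_mul_const _ _
      _ ≤ β * r x := mul_le_mul_of_nonneg_right (h.mass_le x hx0) (h.r_nonneg x hx0)
  have h1 := hge x hxx₀
  simp only [resolvent₁] at h1 hpos
  linarith

/-- `U'`. -/
def deriv₁ (Φ : ℝ) (r U : ℝ → ℝ) (x : ℝ) : ℝ := r x + Φ * U x

/-- `U''`. -/
def deriv₂ (Φ β : ℝ) (m r U : ℝ → ℝ) (x : ℝ) : ℝ := resolvent₁ β m r x + Φ * deriv₁ Φ r U x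

/-- `U'''`. -/
def deriv₃ (Φ β : ℝ) (m r U : ℝ → ℝ) (x : ℝ) : ℝ := resolvent₂ β m r x + Φ * deriv₂ Φ β m r U x

theorem continuous_deriv₁ (h : IsReducedScale Φ β a r U) : Continuous (deriv₁ Φ r U) :=
  h.volterra.continuous.add (h.continuous.const_mul _)

theorem continuous_deriv₂ (h : IsReducedScale Φ β a r U) : Continuous (deriv₂ Φ β (a 0) r U) :=
  h.continuous₁.add (h.continuous_deriv₁.const_mul _)

theorem continuous_deriv₃ (h : IsReducedScale Φ β a r U) : Continuous (deriv₃ Φ β (a 0) r U) :=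
  h.continuous₂.add (h.continuous_deriv₂.const_mul _)

theorem hasDerivAt_deriv₁ (h : IsReducedScale Φ β a r U) :
    ∀ x > 0, HasDerivAt (deriv₁ Φ r U) (deriv₂ Φ β (a 0) r U x) x := fun x hx =>
  (h.hasDerivAt₀ x hx).add ((h.hasDerivAt x hx).const_mul Φ)

theorem hasDerivAt_deriv₂ (h : IsReducedScale Φ β a r U) :
    ∀ x > 0, HasDerivAt (deriv₂ Φ β (a 0) r U) (deriv₃ Φ β (a 0) r U x) x := fun x hx =>
  (h.hasDerivAt₁ x hx).add ((h.hasDerivAt_deriv₁ x hx).const_mul Φ)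

theorem deriv₁_zero (h : IsReducedScale Φ β a r U) : deriv₁ Φ r U 0 = 1 := by
  simp [deriv₁, h.r_zero, h.U_zero]

theorem U_pos (h : IsReducedScale Φ β a r U) {x : ℝ} (hx : 0 < x) : 0 < U x := by
  have := h.strictMonoOn (mem_Ici.2 le_rfl) (mem_Ici.2 hx.le) hx
  rwa [h.U_zero] at this

theorem deriv₁_pos (h : IsReducedScale Φ β a r U) : ∀ x ≥ 0, 0 < deriv₁ Φ r U x := by
  intro x hx
  rcases hx.lt_or_eq with hx | hx
  · exact add_pos_of_nonneg_of_pos (h.r_nonneg x hx.le) (mul_pos h.Φ_pos (h.U_pos hx))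
  · rw [← hx, h.deriv₁_zero]; exact one_pos

/-! ### Sign changes of U'' and of the derivative of (1 - S U'')/U' -/

/-- `-e^{-Φx} U''(x)`. -/
def negSlope (Φ β : ℝ) (m r U : ℝ → ℝ) (x : ℝ) : ℝ :=
  -(Real.exp (-Φ * x) * deriv₂ Φ β m r U x)

/-- `e^{-Φx} r''(x)`. -/
def tiltedResolvent₂ (Φ β : ℝ) (m r : ℝ → ℝ) (x : ℝ) : ℝ :=
  Real.exp (-Φ * x) * resolvent₂ β m r x

theorem deriv₂_eq (x : ℝ) :
    deriv₂ Φ β (a 0) r U x = -(Real.exp (Φ * x) * negSlope Φ β (a 0) r U x) := by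
  rw [negSlope, mul_neg, neg_neg, ← mul_assoc, ← Real.exp_add]; simp

theorem deriv₃_eq (x : ℝ) : deriv₃ Φ β (a 0) r U x = Real.exp (Φ * x) *
    (tiltedResolvent₂ Φ β (a 0) r x - Φ * negSlope Φ β (a 0) r U x) := by
  have : Real.exp (Φ * x) * Real.exp (-Φ * x) = 1 := by rw [← Real.exp_add]; simp
  rw [negSlope, tiltedResolvent₂, deriv₃]
  linear_combination -(resolvent₂ β (a 0) r x + Φ * deriv₂ Φ β (a 0) r U x) * this

theorem continuous_negSlope (h : IsReducedScale Φ β a r U) :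
    Continuous (negSlope Φ β (a 0) r U) :=
  ((by fun_prop : Continuous fun x => Real.exp (-Φ * x)).mul h.continuous_deriv₂).neg

theorem continuous_tilted (h : IsReducedScale Φ β a r U) :
    Continuous (tiltedResolvent₂ Φ β (a 0) r) :=
  (by fun_prop : Continuous fun x => Real.exp (-Φ * x)).mul h.continuous₂

theorem tilted_pos (h : IsReducedScale Φ β a r U) :
    ∀ x > 0, 0 < tiltedResolvent₂ Φ β (a 0) r x := fun x hx =>
  mul_pos (Real.exp_pos _) (h.resolvent₂_pos x hx)

/-- Since U''' - ΦU'' = r'', the factor e^{-Φx} removes the exponentially growing part; positivity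
of r'' then allows at most one zero of U''. -/
theorem hasDerivAt_negSlope (h : IsReducedScale Φ β a r U) :
    ∀ x > 0, HasDerivAt (negSlope Φ β (a 0) r U) (-tiltedResolvent₂ Φ β (a 0) r x) x := by
  intro x hx
  have he : HasDerivAt (fun x => Real.exp (-Φ * x)) (Real.exp (-Φ * x) * -Φ) x := by
    simpa using ((hasDerivAt_id x).const_mul (-Φ)).exp
  refine (he.mul (h.hasDerivAt_deriv₂ x hx)).neg.congr_deriv ?_
  simp only [tiltedResolvent₂, deriv₃]; ring

theorem exists_hasDerivAt_tilted (h : IsReducedScale Φ β a r U) :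
    ∃ p' : ℝ → ℝ, ∀ x > 0, HasDerivAt (tiltedResolvent₂ Φ β (a 0) r) (p' x) x := by
  obtain ⟨r₃, hr₃⟩ := h.exists_hasDerivAt₂
  refine ⟨_, fun x hx => HasDerivAt.mul (c' := Real.exp (-Φ * x) * -Φ) ?_ (hr₃ x hx)⟩
  simpa using ((hasDerivAt_id x).const_mul (-Φ)).exp

theorem convexOn_exp_mul_tilted (h : IsReducedScale Φ β a r U) (α : ℝ) :
    ConvexOn ℝ (Ioi 0) fun x => Real.exp (α * x) * tiltedResolvent₂ Φ β (a 0) r x := by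
  refine (h.convexOn_exp_mul (α - Φ)).congr fun x _ => ?_
  simp only [tiltedResolvent₂]
  rw [← mul_assoc, ← Real.exp_add]; ring_nf

theorem strictAntiOn_negSlope (h : IsReducedScale Φ β a r U) :
    StrictAntiOn (negSlope Φ β (a 0) r U) (Ici 0) :=
  strictAntiOn_of_hasDerivWithinAt_neg (convex_Ici 0) h.continuous_negSlope.continuousOn
    (fun x hx => (h.hasDerivAt_negSlope x (by rwa [interior_Ici] at hx)).hasDerivWithinAt)
    (fun x hx => neg_neg_of_pos (h.tilted_pos x (by rwa [interior_Ici] at hx)))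

theorem negSlope_zero (h : IsReducedScale Φ β a r U) : negSlope Φ β (a 0) r U 0 = β - Φ := by
  simp [negSlope, deriv₂, h.deriv₁_zero, h.resolvent₁_zero]; ring

/-- If U'' ≤ 0 throughout, then U' ≤ U'(0) = 1; but U' ≥ ΦU, and U grows at least linearly. -/
theorem exists_negSlope_neg (h : IsReducedScale Φ β a r U) :
    ∃ x > 0, negSlope Φ β (a 0) r U x < 0 := by
  by_contra! hcon
  have hanti : AntitoneOn (deriv₁ Φ r U) (Ici 0) := by
    refine antitoneOn_of_hasDerivWithinAt_nonpos (convex_Ici 0) h.continuous_deriv₁.continuousOn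
      (fun x hx => (h.hasDerivAt_deriv₁ x (by rwa [interior_Ici] at hx)).hasDerivWithinAt)
      fun x hx => ?_
    rw [interior_Ici] at hx
    rw [deriv₂_eq]
    exact neg_nonpos.2 (mul_nonneg (Real.exp_pos _).le (hcon x hx))
  set v := Φ * U 1 with hv
  have hv0 : 0 < v := mul_pos h.Φ_pos (h.U_pos one_pos)
  have hlow : ∀ x ≥ 0, Φ * U x ≤ deriv₁ Φ r U x := fun x hx => by
    rw [deriv₁]; linarith [h.r_nonneg x hx]
  have hlin : MonotoneOn (fun x => U x - v * x) (Ici 1) := by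
    refine monotoneOn_of_hasDerivWithinAt_nonneg (convex_Ici 1)
      (h.continuous.sub (by fun_prop)).continuousOn
      (fun x hx => ((h.hasDerivAt x ?_).sub ((hasDerivAt_id x).const_mul v)).hasDerivWithinAt)
      fun x hx => ?_
    · rw [interior_Ici] at hx; exact one_pos.trans hx
    · rw [interior_Ici] at hx
      have hx0 : (0 : ℝ) ≤ x := (one_pos.trans hx).le
      have h1 := hlow x hx0
      have h2 : U 1 ≤ U x := h.strictMonoOn.monotoneOn (mem_Ici.2 zero_le_one) hx0 (le_of_lt hx)
      have h3 : v ≤ Φ * U x := mul_le_mul_of_nonneg_left h2 h.Φ_pos.le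
      simp only [deriv₁] at h1
      linarith
  -- Chosen so that ΦU(x) ≥ v + 1 > 1.
  set x := 1 + 1 / (Φ * v) with hx
  have hΦ := h.Φ_pos
  have hx1 : 1 ≤ x := by
    have : 0 ≤ 1 / (Φ * v) := by positivity
    linarith
  have h1 := hlin (mem_Ici.2 le_rfl) (mem_Ici.2 hx1) hx1
  have h2 := hanti (mem_Ici.2 le_rfl) (mem_Ici.2 (by linarith : 0 ≤ x)) (by linarith)
  have h3 := hlow x (by linarith)
  rw [h.deriv₁_zero] at h2
  have h4 : v * x = v + 1 / Φ := by rw [hx]; field_simp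
  have h5 : U 1 + 1 / Φ ≤ U x := by simp only at h1; linarith
  have h6 : Φ * (U 1 + 1 / Φ) ≤ Φ * U x := mul_le_mul_of_nonneg_left h5 hΦ.le
  have h7 : Φ * (U 1 + 1 / Φ) = v + 1 := by rw [hv]; field_simp
  linarith

/-- `U''` has exactly one zero. -/
theorem exists_negSlope_eq_zero (h : IsReducedScale Φ β a r U) :
    ∃ b > 0, negSlope Φ β (a 0) r U b = 0 := by
  obtain ⟨x, hx, hneg⟩ := h.exists_negSlope_neg
  have h0 : 0 < negSlope Φ β (a 0) r U 0 := by rw [h.negSlope_zero]; linarith [h.Φ_lt]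
  obtain ⟨b, hb, hb0⟩ := intermediate_value_Icc' hx.le h.continuous_negSlope.continuousOn
    (mem_Icc.2 ⟨hneg.le, h0.le⟩)
  refine ⟨b, hb.1.lt_of_ne fun hb' => ?_, hb0⟩
  rw [← hb'] at hb0
  exact h0.ne' hb0

/-- `e^{-Φx} (U')²` times the derivative of `(1 - S U'') / U'`. -/
def numerator (Φ β S : ℝ) (m r U : ℝ → ℝ) (x : ℝ) : ℝ :=
  negSlope Φ β m r U x * (1 - S * resolvent₁ β m r x)
    - S * deriv₁ Φ r U x * tiltedResolvent₂ Φ β m r x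

/-- In the quotient rule the terms S Φ U' U'' cancel once U'' = r' + ΦU' and U''' = r'' + ΦU'' are
inserted. -/
theorem hasDerivAt_ratio (h : IsReducedScale Φ β a r U) (S : ℝ) : ∀ x > 0,
    HasDerivAt (fun x => (1 - S * deriv₂ Φ β (a 0) r U x) / deriv₁ Φ r U x)
      (Real.exp (Φ * x) * numerator Φ β S (a 0) r U x / deriv₁ Φ r U x ^ 2) x := by
  intro x hx
  have h1 := (((h.hasDerivAt_deriv₂ x hx).const_mul S).const_sub 1).div
    (h.hasDerivAt_deriv₁ x hx) (h.deriv₁_pos x hx.le).ne'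
  refine h1.congr_deriv ?_
  congr 1
  have h2 : resolvent₁ β (a 0) r x = deriv₂ Φ β (a 0) r U x - Φ * deriv₁ Φ r U x := by
    rw [deriv₂]; ring
  rw [numerator, h2, deriv₃_eq, deriv₂_eq]
  ring

theorem continuous_numerator (h : IsReducedScale Φ β a r U) (S : ℝ) :
    Continuous (numerator Φ β S (a 0) r U) :=
  (h.continuous_negSlope.mul (continuous_const.sub (h.continuous₁.const_mul S))).sub
    ((h.continuous_deriv₁.const_mul S).mul h.continuous_tilted)

/-- For the scale function this value is (c - S(Π(0,∞) + q))/κ, so its positivity is exactly the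
bound imposed on S. -/
theorem numerator_zero (h : IsReducedScale Φ β a r U) (S : ℝ) :
    numerator Φ β S (a 0) r U 0 = β - Φ - S * (Φ * β + a 0 0) := by
  simp only [numerator, h.negSlope_zero, h.resolvent₁_zero, h.deriv₁_zero, tiltedResolvent₂,
    h.resolvent₂_zero, mul_zero, Real.exp_zero]
  ring

theorem numerator_neg_of_ge (h : IsReducedScale Φ β a r U) {S : ℝ} (hS : 0 < S) {x : ℝ}
    (hx : 0 < x) (hk : negSlope Φ β (a 0) r U x ≤ 0) : numerator Φ β S (a 0) r U x < 0 := by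
  have h1 : 0 ≤ 1 - S * resolvent₁ β (a 0) r x := by
    have := mul_nonpos_of_nonneg_of_nonpos hS.le (h.resolvent₁_nonpos x hx.le)
    linarith
  have h2 := mul_nonpos_of_nonpos_of_nonneg hk h1
  have h3 := mul_pos (mul_pos hS (h.deriv₁_pos x hx.le)) (h.tilted_pos x hx)
  rw [numerator]; linarith

/-- The sign of the numerator changes at most once, from `+` to `-`. -/
theorem numerator_neg_of_lt (h : IsReducedScale Φ β a r U) {S : ℝ} (hS : 0 < S)
    (hS0 : 0 < numerator Φ β S (a 0) r U 0) {x₁ x₂ : ℝ} (hx₁ : 0 < x₁) (hx : x₁ < x₂)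
    (hN : numerator Φ β S (a 0) r U x₁ ≤ 0) : numerator Φ β S (a 0) r U x₂ < 0 := by
  rcases le_or_gt (negSlope Φ β (a 0) r U x₂) 0 with hk₂ | hk₂
  · exact h.numerator_neg_of_ge hS (hx₁.trans hx) hk₂
  set k := negSlope Φ β (a 0) r U with hk
  set p := tiltedResolvent₂ Φ β (a 0) r with hp
  set G := deriv₁ Φ r U with hG
  obtain ⟨p', hp'⟩ := h.exists_hasDerivAt_tilted
  have hkpos : ∀ x ∈ Icc 0 x₂, 0 < k x := fun x hx' =>
    hk₂.trans_le (h.strictAntiOn_negSlope.antitoneOn hx'.1 (mem_Ici.2 (hx₁.trans hx).le) hx'.2)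
  -- As k > 0 on [0, x₂], the sign of the numerator there is the sign of 1 - S K. In K' the term
  -- U''p/k cancels r''.
  set K : ℝ → ℝ := fun x => G x * p x / k x + resolvent₁ β (a 0) r x with hK
  have hNK : ∀ x ∈ Icc 0 x₂, numerator Φ β S (a 0) r U x = k x * (1 - S * K x) := by
    intro x hx'
    have := (hkpos x hx').ne'
    simp only [numerator, hK, ← hk, ← hp, ← hG]
    field_simp
    ring
  have hKd : ∀ x ∈ Ioc 0 x₂, HasDerivAt K (G x * (p' x * k x + p x ^ 2) / k x ^ 2) x := by
    intro x hx'
    have hkx := (hkpos x ⟨hx'.1.le, hx'.2⟩).ne'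
    have h1 := (((h.hasDerivAt_deriv₁ x hx'.1).mul (hp' x hx'.1)).div
      (h.hasDerivAt_negSlope x hx'.1) hkx).add (h.hasDerivAt₁ x hx'.1)
    refine h1.congr_deriv ?_
    have h2 : resolvent₂ β (a 0) r x = Real.exp (Φ * x) * p x := by
      rw [hp, tiltedResolvent₂, ← mul_assoc, ← Real.exp_add]; simp
    rw [h2, deriv₂_eq]
    simp only [← hk, ← hp, ← hG, Pi.mul_apply]
    field_simp
    ring
  have hKc : ContinuousOn K (Icc 0 x₂) :=
    ((h.continuous_deriv₁.mul h.continuous_tilted).continuousOn.div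
      h.continuous_negSlope.continuousOn fun x hx' => (hkpos x hx').ne').add
      h.continuous₁.continuousOn
  have hm0 : (0 : ℝ) ∈ Icc 0 x₂ := ⟨le_rfl, by linarith⟩
  have hm1 : x₁ ∈ Icc 0 x₂ := ⟨hx₁.le, hx.le⟩
  have hm2 : x₂ ∈ Icc 0 x₂ := ⟨by linarith, le_rfl⟩
  have hK0 : S * K 0 < 1 := by
    rw [hNK 0 hm0] at hS0
    have := pos_of_mul_pos_right hS0 (hkpos 0 hm0).le
    linarith
  have hK1 : 1 ≤ S * K x₁ := by
    rw [hNK x₁ hm1] at hN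
    by_contra! hcon
    have := mul_pos (hkpos x₁ hm1) (sub_pos.2 hcon)
    linarith
  -- K rises from below 1/S at 0 to at least 1/S at x₁, so K' > 0 at some ξ between them.
  obtain ⟨ξ, hξ, hξe⟩ := exists_hasDerivAt_eq_slope K _ hx₁
    (hKc.mono (Icc_subset_Icc_right hx.le)) fun x hx' => hKd x ⟨hx'.1, hx'.2.le.trans hx.le⟩
  have hξx₂ : ξ ≤ x₂ := hξ.2.le.trans hx.le
  have hkξ := hkpos ξ ⟨hξ.1.le, hξx₂⟩
  have hGpos := h.deriv₁_pos
  have hppos := h.tilted_pos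
  have hQ : 0 < p' ξ * k ξ + p ξ ^ 2 := by
    have h1 : 0 < (K x₁ - K 0) / (x₁ - 0) := by
      refine div_pos (sub_pos.2 ?_) (by linarith)
      exact lt_of_mul_lt_mul_left (hK0.trans_le hK1) hS.le
    rw [← hξe] at h1
    have h2 := (div_pos_iff_of_pos_right (by positivity : 0 < k ξ ^ 2)).1 h1
    exact pos_of_mul_pos_right h2 (hGpos ξ hξ.1.le).le
  set L := p' ξ / p ξ with hL
  have hpξ : 0 < p ξ := hppos ξ hξ.1
  have hLe : p' ξ = L * p ξ := (div_mul_cancel₀ _ hpξ.ne').symm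
  have hLp : ∀ y ≥ ξ, L * p y ≤ p' y := fun y hy =>
    deriv_ge_of_convexOn_exp_mul hp' h.convexOn_exp_mul_tilted hξ.1 hy hLe
  -- L is frozen at p'(ξ)/p(ξ). Log-convexity gives p' ≥ L p beyond ξ, and k' = -p, so p + L k does
  -- not decrease. It is positive at ξ because p(p + L k) = p'k + p² there, and afterwards p'k + p²
  -- ≥ p(p + L k) > 0.
  have hmono : MonotoneOn (fun y => p y + L * k y) (Ici ξ) := by
    refine monotoneOn_of_hasDerivWithinAt_nonneg (f' := fun y => p' y + L * -p y) (convex_Ici ξ)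
      (h.continuous_tilted.add (h.continuous_negSlope.const_mul L)).continuousOn
      (fun y hy => ?_) fun y hy => ?_
    · have hy' : 0 < y := hξ.1.trans_le (interior_subset hy)
      exact ((hp' y hy').add ((h.hasDerivAt_negSlope y hy').const_mul L)).hasDerivWithinAt
    · have := hLp y (interior_subset hy)
      linarith
  have hstart : 0 < p ξ + L * k ξ := by
    rw [hLe] at hQ
    have : p ξ * (p ξ + L * k ξ) = L * p ξ * k ξ + p ξ ^ 2 := by ring
    rw [← this] at hQ
    exact pos_of_mul_pos_right hQ hpξ.le
  have hKmono : StrictMonoOn K (Icc x₁ x₂) := by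
    refine strictMonoOn_of_hasDerivWithinAt_pos (convex_Icc x₁ x₂)
      (hKc.mono (Icc_subset_Icc_left hx₁.le))
      (fun y hy => (hKd y ?_).hasDerivWithinAt) fun y hy => ?_
    · have := interior_subset hy; exact ⟨hx₁.trans_le this.1, this.2⟩
    · have hy' := interior_subset hy
      have hy0 : 0 < y := hx₁.trans_le hy'.1
      have hξy : ξ ≤ y := hξ.2.le.trans hy'.1
      have hky := hkpos y ⟨hy0.le, hy'.2⟩
      have h1 : 0 < p y + L * k y := hstart.trans_le (hmono (mem_Ici.2 le_rfl) hξy hξy)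
      have h2 : L * p y * k y ≤ p' y * k y := mul_le_mul_of_nonneg_right (hLp y hξy) hky.le
      have h3 := mul_pos (hppos y hy0) h1
      refine div_pos (mul_pos (hGpos y hy0.le) ?_) (by positivity)
      linarith
  have hlt := hKmono ⟨le_rfl, hx.le⟩ ⟨hx.le, le_rfl⟩ hx
  rw [hNK x₂ hm2]
  refine mul_neg_of_pos_of_neg (hkpos x₂ hm2) ?_
  have := mul_lt_mul_of_pos_left hlt hS
  linarith

end IsReducedScale

/-! ### The kernel: exponentially tilted tails of the Lévy density -/

/-- The functions `(-1)ⁿ m⁽ⁿ⁾` when `m' = Φ m - b 0`. -/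
def tailChain (Φ : ℝ) (m : ℝ → ℝ) (b : ℕ → ℝ → ℝ) : ℕ → ℝ → ℝ
  | 0 => m
  | n + 1 => fun x => b n x - Φ * tailChain Φ m b n x

/-- A bounded solution of `m' = Φ m - b 0` inherits complete monotonicity from `b`. -/
theorem IsCompletelyMonotoneChain.tailChain {Φ : ℝ} {m : ℝ → ℝ} {b : ℕ → ℝ → ℝ}
    (hb : IsCompletelyMonotoneChain b) (hΦ : 0 < Φ)
    (hm : ∀ x > 0, HasDerivAt m (Φ * m x - b 0 x) x) {C : ℝ} (hC : ∀ x ≥ 1, |m x| ≤ C) :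
    IsCompletelyMonotoneChain (_root_.tailChain Φ m b) := by
  have hd : ∀ n, ∀ x > 0, HasDerivAt (_root_.tailChain Φ m b n)
      (-_root_.tailChain Φ m b (n + 1) x) x := by
    intro n
    induction n with
    | zero => intro x hx; exact (hm x hx).congr_deriv (by simp [_root_.tailChain])
    | succ n ih =>
      intro x hx
      refine ((hb.hasDerivAt n x hx).sub ((ih x hx).const_mul Φ)).congr_deriv ?_
      simp only [_root_.tailChain]; ring
  have hbb : ∀ n, ∀ x ≥ 1, |b n x| ≤ b n 1 := by
    intro n x hx
    rw [abs_of_nonneg (hb.nonneg n x (by linarith))]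
    have hanti : AntitoneOn (b n) (Icc 1 x) := by
      refine antitoneOn_of_hasDerivWithinAt_nonpos (f' := fun z => -b (n + 1) z) (convex_Icc 1 x)
        (fun z hz => (hb.hasDerivAt n z (by linarith [hz.1])).continuousAt.continuousWithinAt)
        (fun z hz => (hb.hasDerivAt n z ?_).hasDerivWithinAt) fun z hz => ?_
      · linarith [(interior_subset hz).1]
      · exact neg_nonpos.2 (hb.nonneg (n + 1) z (by linarith [(interior_subset hz).1]))
    exact hanti ⟨le_rfl, hx⟩ ⟨hx, le_rfl⟩ hx
  have hbd : ∀ n, ∃ C, ∀ x ≥ 1, |_root_.tailChain Φ m b n x| ≤ C := by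
    intro n
    induction n with
    | zero => exact ⟨C, hC⟩
    | succ n ih =>
      obtain ⟨C, hC⟩ := ih
      refine ⟨b n 1 + Φ * C, fun x hx => ?_⟩
      refine (abs_sub _ _).trans (add_le_add (hbb n x hx) ?_)
      rw [abs_mul, abs_of_pos hΦ]
      exact mul_le_mul_of_nonneg_left (hC x hx) hΦ.le
  refine ⟨fun n x hx => ?_, hd⟩
  set f := _root_.tailChain Φ m b n with hf
  have hfd : ∀ z > 0, HasDerivAt (fun z => Real.exp (-Φ * z) * f z)
      (-(Real.exp (-Φ * z) * b n z)) z := by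
    intro z hz
    have he : HasDerivAt (fun z => Real.exp (-Φ * z)) (Real.exp (-Φ * z) * -Φ) z := by
      simpa using ((hasDerivAt_id z).const_mul (-Φ)).exp
    refine (he.mul (hd n z hz)).congr_deriv ?_
    simp only [_root_.tailChain, ← hf]; ring
  -- Each e^{-Φz} f(z) is antitone and, f being bounded on [1, ∞), tends to 0; hence it is
  -- nonnegative.
  have hanti : AntitoneOn (fun z => Real.exp (-Φ * z) * f z) (Ici x) := by
    refine antitoneOn_of_hasDerivWithinAt_nonpos (convex_Ici x)
      (fun z hz => (hfd z (hx.trans_le hz)).continuousAt.continuousWithinAt)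
      (fun z hz => (hfd z (hx.trans_le (interior_subset hz))).hasDerivWithinAt) fun z hz => ?_
    exact neg_nonpos.2 (mul_nonneg (Real.exp_pos _).le
      (hb.nonneg n z (hx.trans_le (interior_subset hz))))
  obtain ⟨D, hD⟩ := hbd n
  have hexp : Tendsto (fun z => Real.exp (-Φ * z)) atTop (𝓝 0) :=
    Real.tendsto_exp_atBot.comp (tendsto_id.const_mul_atTop_of_neg (neg_neg_of_pos hΦ))
  have hlim : Tendsto (fun z => Real.exp (-Φ * z) * f z) atTop (𝓝 0) := by
    refine squeeze_zero_norm' (a := fun z => Real.exp (-Φ * z) * D) ?_ (by simpa using hexp.mul_const D)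
    filter_upwards [eventually_ge_atTop 1] with z hz
    rw [norm_mul, Real.norm_eq_abs, Real.norm_eq_abs, Real.abs_exp]
    exact mul_le_mul_of_nonneg_left (hD z hz) (Real.exp_pos _).le
  have h0 : 0 ≤ Real.exp (-Φ * x) * f x := by
    refine le_of_tendsto hlim ?_
    filter_upwards [eventually_ge_atTop x] with z hz
    exact hanti (mem_Ici.2 le_rfl) (mem_Ici.2 hz) hz
  exact nonneg_of_mul_nonneg_right h0 (Real.exp_pos _)

theorem IsCompletelyMonotoneChain.const_mul {a : ℕ → ℝ → ℝ} (h : IsCompletelyMonotoneChain a)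
    {c : ℝ} (hc : 0 ≤ c) : IsCompletelyMonotoneChain fun n x => c * a n x :=
  ⟨fun n x hx => mul_nonneg hc (h.nonneg n x hx), fun n x hx =>
    ((h.hasDerivAt n x hx).const_mul c).congr_deriv (by ring)⟩

theorem isCompletelyMonotoneChain_iteratedDeriv {ρ : ℝ → ℝ} (hρ : ContDiffOn ℝ ∞ ρ (Ioi 0))
    (hsign : ∀ n : ℕ, ∀ x : ℝ, 0 < x → 0 ≤ (-1) ^ n * iteratedDeriv n ρ x) :
    IsCompletelyMonotoneChain fun n x => (-1) ^ n * iteratedDeriv n ρ x := by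
  refine ⟨fun n x hx => hsign n x hx, fun n x hx => ?_⟩
  have hdiff : DifferentiableAt ℝ (iteratedDeriv n ρ) x := by
    have h1 := hρ.differentiableOn_iteratedDerivWithin (m := n)
      (by exact_mod_cast WithTop.coe_lt_top n) isOpen_Ioi.uniqueDiffOn
    have h2 := h1.congr fun y hy => (iteratedDerivWithin_of_isOpen isOpen_Ioi hy).symm
    exact (h2 x hx).differentiableAt (Ioi_mem_nhds hx)
  refine (hdiff.hasDerivAt.const_mul ((-1) ^ n)).congr_deriv ?_
  rw [iteratedDeriv_succ, pow_succ]; ring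

/-- Integrability and Laplace transform of a density, and its exponentially tilted tail. -/
structure IsLevyDensity (ρ : ℝ → ℝ) : Prop where
  integrable : Integrable ρ
  nonneg : ∀ x, 0 ≤ ρ x
  eq_zero : ∀ x ≤ 0, ρ x = 0
  continuousAt : ∀ x > 0, ContinuousAt ρ x

namespace IsLevyDensity

variable {ρ : ℝ → ℝ}

/-- `∫ e^{-θx} ρ(x) dx`. -/
def laplace (ρ : ℝ → ℝ) (θ : ℝ) : ℝ := ∫ x in Ioi 0, Real.exp (-θ * x) * ρ x

/-- `e^{Φx} ∫ₓ^∞ e^{-Φy} ρ(y) dy`. -/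
def tail (Φ : ℝ) (ρ : ℝ → ℝ) (x : ℝ) : ℝ :=
  Real.exp (Φ * x) * (laplace ρ Φ - ∫ y in (0 : ℝ)..x, Real.exp (-Φ * y) * ρ y)

theorem integrable_exp_mul (h : IsLevyDensity ρ) {θ : ℝ} (hθ : 0 ≤ θ) :
    Integrable fun x => Real.exp (-θ * x) * ρ x := by
  refine h.integrable.mono ((by fun_prop : Continuous fun x => Real.exp (-θ * x)).aestronglyMeasurable.mul
    h.integrable.aestronglyMeasurable) (ae_of_all _ fun x => ?_)
  rw [norm_mul]
  rcases le_or_gt x 0 with hx | hx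
  · simp [h.eq_zero x hx]
  · refine mul_le_of_le_one_left (norm_nonneg _) ?_
    rw [Real.norm_eq_abs, Real.abs_exp, Real.exp_le_one_iff]
    nlinarith

theorem hasLaplace (h : IsLevyDensity ρ) {θ : ℝ} (hθ : 0 ≤ θ) : HasLaplace ρ θ (laplace ρ θ) :=
  ⟨(h.integrable_exp_mul hθ).integrableOn, rfl⟩

theorem laplace_nonneg (h : IsLevyDensity ρ) (θ : ℝ) : 0 ≤ laplace ρ θ :=
  setIntegral_nonneg measurableSet_Ioi fun x _ => mul_nonneg (Real.exp_pos _).le (h.nonneg x)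

theorem continuous_tail (h : IsLevyDensity ρ) {Φ : ℝ} (hΦ : 0 ≤ Φ) : Continuous (tail Φ ρ) := by
  have := intervalIntegral.continuous_primitive
    (fun a b => (h.integrable_exp_mul hΦ).intervalIntegrable (a := a) (b := b)) 0
  unfold tail
  fun_prop

theorem tail_zero (Φ : ℝ) : tail Φ ρ 0 = laplace ρ Φ := by simp [tail]

theorem hasDerivAt_tail (h : IsLevyDensity ρ) {Φ : ℝ} (hΦ : 0 ≤ Φ) :
    ∀ x > 0, HasDerivAt (tail Φ ρ) (Φ * tail Φ ρ x - ρ x) x := by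
  intro x hx
  have h1 : HasDerivAt (fun x => ∫ y in (0 : ℝ)..x, Real.exp (-Φ * y) * ρ y)
      (Real.exp (-Φ * x) * ρ x) x := by
    refine intervalIntegral.integral_hasDerivAt_right
      (h.integrable_exp_mul hΦ).intervalIntegrable
      ((h.integrable_exp_mul hΦ).aestronglyMeasurable.stronglyMeasurableAtFilter) ?_
    exact (by fun_prop : Continuous fun x => Real.exp (-Φ * x)).continuousAt.mul (h.continuousAt x hx)
  have he : HasDerivAt (fun x => Real.exp (Φ * x)) (Real.exp (Φ * x) * Φ) x := by
    simpa using ((hasDerivAt_id x).const_mul Φ).exp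
  refine (he.mul (h1.const_sub _)).congr_deriv ?_
  have e : Real.exp (Φ * x) * Real.exp (-Φ * x) = 1 := by rw [← Real.exp_add]; simp
  simp only [tail]
  linear_combination -ρ x * e

theorem tail_eq_integral (h : IsLevyDensity ρ) {Φ : ℝ} (hΦ : 0 ≤ Φ) (x : ℝ) :
    tail Φ ρ x = ∫ y in Ioi x, Real.exp (Φ * (x - y)) * ρ y := by
  have hint := h.integrable_exp_mul hΦ
  have h1 := intervalIntegral.integral_interval_add_Ioi (hint.integrableOn (s := Ioi 0))
    (hint.integrableOn (s := Ioi x))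
  rw [tail, laplace, ← h1, add_sub_cancel_left, ← integral_const_mul]
  refine setIntegral_congr_fun measurableSet_Ioi fun y _ => ?_
  rw [← mul_assoc, ← Real.exp_add]; ring_nf

theorem tail_nonneg (h : IsLevyDensity ρ) {Φ : ℝ} (hΦ : 0 ≤ Φ) (x : ℝ) :
    0 ≤ tail Φ ρ x := by
  rw [h.tail_eq_integral hΦ x]
  exact setIntegral_nonneg measurableSet_Ioi fun y _ =>
    mul_nonneg (Real.exp_pos _).le (h.nonneg y)

theorem tail_le (h : IsLevyDensity ρ) {Φ : ℝ} (hΦ : 0 ≤ Φ) (x : ℝ) :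
    tail Φ ρ x ≤ laplace ρ 0 - ∫ y in (0 : ℝ)..x, ρ y := by
  have h0 : tail 0 ρ x = laplace ρ 0 - ∫ y in (0 : ℝ)..x, ρ y := by simp [tail]
  rw [← h0, h.tail_eq_integral hΦ x, h.tail_eq_integral le_rfl x]
  refine setIntegral_mono_on ?_ ?_ measurableSet_Ioi fun y hy => ?_
  · refine ((h.integrable_exp_mul hΦ).const_mul (Real.exp (Φ * x))).integrableOn.congr_fun
      (fun y _ => ?_) measurableSet_Ioi
    simp only
    rw [← mul_assoc, ← Real.exp_add]; ring_nf
  · simpa using h.integrable.integrableOn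
  · refine mul_le_mul_of_nonneg_right (Real.exp_le_exp.2 ?_) (h.nonneg y)
    have : x - y ≤ 0 := by linarith [mem_Ioi.1 hy]
    rw [zero_mul]
    exact mul_nonpos_of_nonneg_of_nonpos hΦ this

theorem integral_density_nonneg (h : IsLevyDensity ρ) {x : ℝ} (hx : 0 ≤ x) :
    0 ≤ ∫ y in (0 : ℝ)..x, ρ y := intervalIntegral.integral_nonneg hx fun y _ => h.nonneg y

theorem abs_tail_le (h : IsLevyDensity ρ) {Φ : ℝ} (hΦ : 0 ≤ Φ) {x : ℝ} (hx : 0 ≤ x) :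
    |tail Φ ρ x| ≤ laplace ρ 0 := by
  rw [abs_of_nonneg (h.tail_nonneg hΦ x)]
  linarith [h.tail_le hΦ x, h.integral_density_nonneg hx]

theorem tail_eq (h : IsLevyDensity ρ) {Φ : ℝ} (hΦ : 0 ≤ Φ) {x : ℝ} (hx : 0 ≤ x) :
    tail Φ ρ x = laplace ρ Φ + Φ * (∫ y in (0 : ℝ)..x, tail Φ ρ y) - ∫ y in (0 : ℝ)..x, ρ y := by
  have hc := h.continuous_tail hΦ
  have hi1 : IntervalIntegrable (fun y => Φ * tail Φ ρ y) volume 0 x :=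
    (hc.const_mul Φ).intervalIntegrable _ _
  have hi2 : IntervalIntegrable ρ volume 0 x := h.integrable.intervalIntegrable
  have h1 := intervalIntegral.integral_eq_sub_of_hasDerivAt_of_le hx hc.continuousOn
    (fun y hy => h.hasDerivAt_tail hΦ y hy.1) (hi1.sub hi2)
  rw [intervalIntegral.integral_sub hi1 hi2, intervalIntegral.integral_const_mul, tail_zero] at h1
  linarith

/-- Combined with ψ_X(Φ) = q this bounds the total mass of the Volterra kernel by β. -/
theorem mul_integral_tail_le (h : IsLevyDensity ρ) {Φ : ℝ} (hΦ : 0 ≤ Φ) {x : ℝ} (hx : 0 ≤ x) :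
    Φ * (∫ y in (0 : ℝ)..x, tail Φ ρ y) ≤ laplace ρ 0 - laplace ρ Φ := by
  linarith [h.tail_eq hΦ hx, h.tail_le hΦ x]

/-- The integrated form of m' = Φm - ρ becomes a linear equation for the transform. -/
theorem hasLaplace_tail (h : IsLevyDensity ρ) {Φ θ : ℝ} (hΦ : 0 ≤ Φ) (hθ : Φ < θ) :
    HasLaplace (tail Φ ρ) θ ((laplace ρ Φ - laplace ρ θ) / (θ - Φ)) := by
  have hθ0 : 0 < θ := hΦ.trans_lt hθ
  have hint : IntegrableOn (fun x => Real.exp (-θ * x) * tail Φ ρ x) (Ioi 0) := by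
    have h1 : IntegrableOn (fun x => Real.exp (-θ * x)) (Ioi 0) :=
      integrableOn_exp_mul_Ioi (by linarith) 0
    refine Integrable.mul_bdd (c := laplace ρ 0) h1
      (h.continuous_tail hΦ).aestronglyMeasurable ?_
    filter_upwards [ae_restrict_mem measurableSet_Ioi] with x hx
    exact h.abs_tail_le hΦ (le_of_lt hx)
  have hL : HasLaplace (tail Φ ρ) θ (∫ x in Ioi 0, Real.exp (-θ * x) * tail Φ ρ x) := ⟨hint, rfl⟩
  set L := ∫ x in Ioi 0, Real.exp (-θ * x) * tail Φ ρ x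
  have hone := HasLaplace.one hθ0
  have h2 := ((hone.const_mul (laplace ρ Φ)).add ((hL.conv hone).const_mul Φ)).sub
    ((h.hasLaplace hθ0.le).conv hone)
  have h3 := h2.congr (g := tail Φ ρ) fun x hx => by
    simp only [halfConv, mul_one]
    exact (h.tail_eq hΦ hx.le).symm
  have h4 := hL.2.symm.trans h3.2
  have h5 : (θ - Φ) ≠ 0 := by linarith
  have h6 : L = (laplace ρ Φ - laplace ρ θ) / (θ - Φ) := by
    rw [eq_div_iff h5]
    field_simp at h4
    linarith
  rwa [← h6]

end IsLevyDensity

/-! ### From the Lévy triplet to the reduced equation -/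

namespace LevyTriplet

variable {X : LevyTriplet}

/-- A finite Lévy measure with a completely monotone
density has an integrable one that vanishes on `(-∞, 0]`. -/
theorem HasCompletelyMonotoneDensity.exists_density (hcm : X.HasCompletelyMonotoneDensity)
    (hfin : X.jump (Ioi 0) < ⊤) :
    ∃ (ρ : ℝ → ℝ) (b : ℕ → ℝ → ℝ), IsLevyDensity ρ ∧ IsCompletelyMonotoneChain b ∧
      (∀ x > 0, b 0 x = ρ x) ∧
      ∀ f : ℝ → ℝ, ∫ z in Ioi 0, f z ∂X.jump = ∫ z in Ioi 0, f z * ρ z := by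
  obtain ⟨ρ₀, hsm, hsign, hj⟩ := hcm
  have hnn : ∀ x > 0, 0 ≤ ρ₀ x := fun x hx => by simpa using hsign 0 x hx
  have hcont : ContinuousOn ρ₀ (Ioi 0) := hsm.continuousOn
  have haem : AEMeasurable ρ₀ (volume.restrict (Ioi 0)) := hcont.aemeasurable measurableSet_Ioi
  have hrestr : X.jump.restrict (Ioi 0)
      = (volume.restrict (Ioi 0)).withDensity fun x => ENNReal.ofReal (ρ₀ x) := by
    rw [hj, restrict_withDensity measurableSet_Ioi, Measure.restrict_restrict measurableSet_Ioi,
      inter_self]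
  have hint₀ : IntegrableOn ρ₀ (Ioi 0) := by
    refine ⟨haem.aestronglyMeasurable, ?_⟩
    rw [hasFiniteIntegral_iff_ofReal]
    · have h1 : X.jump (Ioi 0) = ∫⁻ x in Ioi 0, ENNReal.ofReal (ρ₀ x) := by
        rw [hj, withDensity_apply _ measurableSet_Ioi, Measure.restrict_restrict measurableSet_Ioi,
          inter_self]
      rwa [← h1]
    · filter_upwards [ae_restrict_mem measurableSet_Ioi] with x hx using hnn x hx
  refine ⟨(Ioi 0).indicator ρ₀, _, ⟨hint₀.integrable_indicator measurableSet_Ioi, fun x => ?_,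
    fun x hx => indicator_of_notMem (by simpa using hx) _, fun x hx => ?_⟩,
    isCompletelyMonotoneChain_iteratedDeriv hsm hsign, fun x hx => ?_, fun f => ?_⟩
  · exact indicator_nonneg (fun x hx => hnn x hx) x
  · refine (hcont.continuousAt (Ioi_mem_nhds hx)).congr ?_
    filter_upwards [Ioi_mem_nhds hx] with y hy
    rw [indicator_of_mem hy]
  · simp [indicator_of_mem (mem_Ioi.2 hx)]
  · rw [hrestr, integral_withDensity_eq_integral_toReal_smul₀ haem.ennreal_ofReal
      (ae_of_all _ fun x => ENNReal.ofReal_lt_top)]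
    refine setIntegral_congr_fun measurableSet_Ioi fun x hx => ?_
    simp only [smul_eq_mul, indicator_of_mem hx, ENNReal.toReal_ofReal (hnn x hx)]
    ring

/-- Since the jump measure is finite, the three terms of the integrand are separately integrable,
and the compensator is absorbed into the drift. -/
theorem laplaceExponent_eq {ρ : ℝ → ℝ} (hfin : X.jump (Ioi 0) < ⊤)
    (hint : ∀ f : ℝ → ℝ, ∫ z in Ioi 0, f z ∂X.jump = ∫ z in Ioi 0, f z * ρ z) {θ : ℝ}
    (hθ : 0 ≤ θ) :
    X.laplaceExponent θ = X.drift * θ + X.σ ^ 2 / 2 * θ ^ 2 - IsLevyDensity.laplace ρ 0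
      + IsLevyDensity.laplace ρ θ := by
  have hfinm : IsFiniteMeasure (X.jump.restrict (Ioi 0)) := ⟨by simpa using hfin⟩
  have hbd : ∀ f : ℝ → ℝ, Measurable f → (∀ z ∈ Ioi (0 : ℝ), |f z| ≤ 1) →
      IntegrableOn f (Ioi 0) X.jump := by
    intro f hf hb
    refine Integrable.of_bound (C := 1) hf.aestronglyMeasurable ?_
    filter_upwards [ae_restrict_mem measurableSet_Ioi] with z hz using hb z hz
  have h1 : IntegrableOn (fun _ : ℝ => (1 : ℝ)) (Ioi 0) X.jump :=
    hbd _ measurable_const fun _ _ => by simp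
  have h2 : IntegrableOn (fun z => Real.exp (-θ * z)) (Ioi 0) X.jump := by
    refine hbd _ (by fun_prop) fun z hz => ?_
    rw [Real.abs_exp, Real.exp_le_one_iff]
    have : 0 ≤ θ * z := mul_nonneg hθ (le_of_lt hz)
    linarith
  have h3 : IntegrableOn (fun z => (Ioo (0 : ℝ) 1).indicator (fun z => z) z) (Ioi 0) X.jump := by
    refine hbd _ (measurable_id.indicator measurableSet_Ioo) fun z _ => ?_
    by_cases hz : z ∈ Ioo (0 : ℝ) 1
    · rw [indicator_of_mem hz, abs_of_pos hz.1]; exact hz.2.le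
    · rw [indicator_of_notMem hz]; simp
  have h4 : ∀ z : ℝ, θ * z * (Ioo (0 : ℝ) 1).indicator 1 z
      = θ * (Ioo (0 : ℝ) 1).indicator (fun z => z) z := by
    intro z
    by_cases hz : z ∈ Ioo (0 : ℝ) 1 <;> simp [hz]
  have h5 : ∫ z in Ioi 0, (Ioo (0 : ℝ) 1).indicator (fun z => z) z ∂X.jump
      = ∫ z in Ioo 0 1, z ∂X.jump := by
    rw [setIntegral_indicator measurableSet_Ioo,
      inter_eq_self_of_subset_right Ioo_subset_Ioi_self]
  rw [laplaceExponent, drift, ← h5]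
  simp only [h4]
  have h12 : IntegrableOn (fun z => 1 - Real.exp (-θ * z)) (Ioi 0) X.jump := h1.sub h2
  rw [integral_sub h12 (h3.const_mul θ), integral_sub h1 h2, integral_const_mul,
    hint fun _ => 1, hint fun z => Real.exp (-θ * z)]
  simp only [IsLevyDensity.laplace, neg_zero, zero_mul, Real.exp_zero]
  ring

theorem jump_real_eq {ρ : ℝ → ℝ}
    (hint : ∀ f : ℝ → ℝ, ∫ z in Ioi 0, f z ∂X.jump = ∫ z in Ioi 0, f z * ρ z) :
    X.jump.real (Ioi 0) = IsLevyDensity.laplace ρ 0 := by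
  have := hint fun _ => 1
  simpa [IsLevyDensity.laplace] using this

theorem continuousOn_laplace {ρ : ℝ → ℝ} (hρ : IsLevyDensity ρ) :
    ContinuousOn (IsLevyDensity.laplace ρ) (Ici 0) := by
  unfold IsLevyDensity.laplace
  refine continuousOn_of_dominated (bound := ρ) (fun θ hθ => ?_) (fun θ hθ => ?_)
    hρ.integrable.integrableOn (ae_of_all _ fun x => by fun_prop)
  · exact (hρ.integrable_exp_mul hθ).aestronglyMeasurable.restrict
  · filter_upwards [ae_restrict_mem measurableSet_Ioi] with x hx
    rw [norm_mul, Real.norm_eq_abs, Real.abs_exp, Real.norm_of_nonneg (hρ.nonneg x)]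
    refine mul_le_of_le_one_left (hρ.nonneg x) (Real.exp_le_one_iff.2 ?_)
    have : 0 ≤ θ * x := mul_nonneg hθ (le_of_lt hx)
    linarith

/-- `Φ(q)` is a positive root of `ψ_X = q`, and the largest one. -/
theorem Phi_spec {ρ : ℝ → ℝ} (hρ : IsLevyDensity ρ) {q : ℝ} (hq : 0 < q) (hσ : 0 < X.σ)
    (hψ : ∀ θ ≥ 0, X.laplaceExponent θ = X.drift * θ + X.σ ^ 2 / 2 * θ ^ 2
      - IsLevyDensity.laplace ρ 0 + IsLevyDensity.laplace ρ θ) (hc : 0 < X.drift) :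
    0 < X.Phi q ∧ X.laplaceExponent (X.Phi q) = q ∧
      ∀ θ > X.Phi q, X.laplaceExponent θ ≠ q := by
  set A := {θ : ℝ | 0 ≤ θ ∧ X.laplaceExponent θ = q} with hA
  have hcont : ContinuousOn X.laplaceExponent (Ici 0) := by
    refine ContinuousOn.congr ?_ fun θ hθ => hψ θ hθ
    have := continuousOn_laplace hρ
    fun_prop
  have hlow : ∀ θ ≥ 0, X.drift * θ - IsLevyDensity.laplace ρ 0 ≤ X.laplaceExponent θ := by
    intro θ hθ
    rw [hψ θ hθ]
    have := hρ.laplace_nonneg θ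
    have : 0 ≤ X.σ ^ 2 / 2 * θ ^ 2 := by positivity
    linarith
  -- The linear lower bound for ψ_X reaches q at T, so T bounds all roots and the intermediate value
  -- theorem finds one in [0, T].
  set T := (q + IsLevyDensity.laplace ρ 0) / X.drift with hT
  have hT0 : 0 ≤ T := div_nonneg (add_nonneg hq.le (hρ.laplace_nonneg 0)) hc.le
  have hcT : X.drift * T = q + IsLevyDensity.laplace ρ 0 := by rw [hT]; field_simp
  have hbdd : BddAbove A := by
    refine ⟨T, fun θ hθ => ?_⟩
    have h1 := hlow θ hθ.1
    rw [hθ.2] at h1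
    rw [hT, le_div_iff₀ hc]
    linarith
  have hne : A.Nonempty := by
    have h0 : X.laplaceExponent 0 = 0 := by rw [hψ 0 le_rfl]; ring
    have h1 : q ≤ X.laplaceExponent T := by linarith [hlow T hT0]
    obtain ⟨θ, hθ, he⟩ := intermediate_value_Icc hT0 (hcont.mono Icc_subset_Ici_self)
      (mem_Icc.2 ⟨by rw [h0]; exact hq.le, h1⟩)
    exact ⟨θ, hθ.1, he⟩
  have hclosed : IsClosed A := hcont.preimage_isClosed_of_isClosed isClosed_Ici isClosed_singleton
  have hmem : X.Phi q ∈ A := hclosed.csSup_mem hne hbdd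
  refine ⟨hmem.1.lt_of_ne fun h => ?_, hmem.2, fun θ hθ he => ?_⟩
  · have := hmem.2
    rw [← h, hψ 0 le_rfl] at this
    linarith
  · exact not_lt_of_ge (le_csSup hbdd (⟨hmem.1.trans hθ.le, he⟩ : θ ∈ A)) hθ

/-- The scale function, up to the factor `σ² / 2`, solves the reduced Volterra equation. -/
theorem IsScaleFunction.exists_reduced {q : ℝ} {W : ℝ → ℝ} (hW : X.IsScaleFunction q W)
    (hq : 0 < q) (hσ : 0 < X.σ) (hfin : X.jump (Ioi 0) < ⊤)
    (hcm : X.HasCompletelyMonotoneDensity) (hc : 0 < X.drift) :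
    ∃ (Φ β : ℝ) (a : ℕ → ℝ → ℝ) (r U : ℝ → ℝ), IsReducedScale Φ β a r U ∧
      (∀ x ≥ 0, W x = U x / (X.σ ^ 2 / 2)) ∧ β - Φ = X.drift / (X.σ ^ 2 / 2) ∧
      Φ * β + a 0 0 = (X.jump.real (Ioi 0) + q) / (X.σ ^ 2 / 2) := by
  obtain ⟨ρ, b, hρ, hb, hb0, hint⟩ := hcm.exists_density hfin
  have hψ := fun θ (hθ : θ ≥ 0) => laplaceExponent_eq hfin hint hθ
  obtain ⟨hΦ, hΦq, hΦmax⟩ := Phi_spec hρ hq hσ hψ hc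
  rw [jump_real_eq hint]
  set Φ := X.Phi q with hΦdef
  set κ := X.σ ^ 2 / 2 with hκ
  set c := X.drift with hcdef
  have hκ0 : 0 < κ := by positivity
  set β := Φ + c / κ with hβ
  have hκβ : κ * β = κ * Φ + c := by rw [hβ]; field_simp
  rw [hψ Φ hΦ.le] at hΦq
  set m := IsLevyDensity.tail Φ ρ with hm
  have hmc : Continuous m := hρ.continuous_tail hΦ.le
  set a : ℕ → ℝ → ℝ := fun n x => κ⁻¹ * tailChain Φ m b n x with ha
  have ha0 : a 0 = fun x => κ⁻¹ * m x := rfl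
  have hchain : IsCompletelyMonotoneChain a := by
    refine (hb.tailChain hΦ (fun x hx => ?_) (C := IsLevyDensity.laplace ρ 0) fun x hx => ?_).const_mul
      (inv_nonneg.2 hκ0.le)
    · rw [hb0 x hx]; exact hρ.hasDerivAt_tail hΦ.le x hx
    · exact hρ.abs_tail_le hΦ.le (by linarith)
  -- W(0) = 0 is not yet known, so W could jump at 0; w is continuous on the whole line.
  set w : ℝ → ℝ := fun x => W (max x 0) with hw
  have hwW : ∀ x ≥ 0, w x = W x := fun x hx => by rw [hw]; simp only [max_eq_left hx]
  have hwc : Continuous w :=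
    hW.continuousOn.comp_continuous (by fun_prop) fun x => mem_Ici.2 (le_max_right _ _)
  -- V is the primitive of r/κ. The equation is treated in integrated form because W is not yet
  -- known to be differentiable.
  set V : ℝ → ℝ := fun x => w x - Φ * halfConv w (fun _ => 1) x with hV
  have hVc : Continuous V := hwc.sub ((continuous_halfConv hwc continuous_const).const_mul Φ)
  have hmVc : Continuous (halfConv m V) := continuous_halfConv hmc hVc
  -- The Volterra equation integrated twice. Its Laplace transform is the factorization ψ_X(θ) - q =
  -- (θ - Φ)(κθ + κβ - m̂(θ)), where m̂ is the transform of m.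
  have heq : ∀ x ≥ 0, κ * V x + κ * β * halfConv V (fun _ => 1) x
      - halfConv (halfConv m V) (fun _ => 1) x - x = 0 := by
    refine eq_zero_of_hasLaplace_zero (θ₀ := Φ) ?_ fun θ hθ => ?_
    · exact (((hVc.const_mul κ).add ((continuous_halfConv hVc continuous_const).const_mul _)).sub
        (continuous_halfConv hmVc continuous_const)).sub continuous_id
    · have hθ0 : 0 < θ := hΦ.trans hθ
      have hwL : HasLaplace w θ (1 / (X.laplaceExponent θ - q)) :=
        HasLaplace.congr ⟨hW.integrableOn θ hθ, hW.laplace θ hθ⟩ fun x hx => (hwW x hx.le).symm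
      have hone := HasLaplace.one hθ0
      have hVL := hwL.sub ((hwL.conv hone).const_mul Φ)
      have hmL := hρ.hasLaplace_tail hΦ.le hθ
      have hEL := (((hVL.const_mul κ).add ((hVL.conv hone).const_mul (κ * β))).sub
        ((hmL.conv hVL).conv hone)).sub (HasLaplace.id hθ0)
      refine ⟨hEL.1, hEL.2.trans ?_⟩
      have hne : X.laplaceExponent θ - q ≠ 0 := sub_ne_zero.2 (hΦmax θ hθ)
      have hθΦ : θ - Φ ≠ 0 := by linarith
      rw [hκβ]
      field_simp
      rw [hψ θ hθ0.le]
      linear_combination -hΦq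
  have hVeq : ∀ x ≥ 0, κ * V x = x - κ * β * (∫ t in (0 : ℝ)..x, V t)
      + ∫ t in (0 : ℝ)..x, halfConv m V t := by
    intro x hx
    have := heq x hx
    simp only [halfConv, mul_one] at this ⊢
    linarith
  have hV0 : V 0 = 0 := by
    have := hVeq 0 le_rfl
    simp only [intervalIntegral.integral_same] at this
    have h2 : κ * V 0 = 0 := by linarith
    exact (mul_eq_zero.1 h2).resolve_left hκ0.ne'
  have hw0 : w 0 = 0 := by
    have := hV0
    simpa [hV, halfConv_zero] using this
  set r : ℝ → ℝ := fun x => 1 - κ * β * V x + halfConv m V x with hr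
  have hrc : Continuous r := (continuous_const.sub (hVc.const_mul _)).add hmVc
  have hVd : ∀ x > 0, HasDerivAt V (κ⁻¹ * r x) x := by
    intro x hx
    have h1 : HasDerivAt (fun x => κ⁻¹ * (x - κ * β * (∫ t in (0 : ℝ)..x, V t)
        + ∫ t in (0 : ℝ)..x, halfConv m V t)) (κ⁻¹ * r x) x :=
      (((hasDerivAt_id x).sub ((hVc.integral_hasStrictDerivAt 0 x).hasDerivAt.const_mul _)).add
        (hmVc.integral_hasStrictDerivAt 0 x).hasDerivAt).const_mul κ⁻¹
    refine h1.congr_of_eventuallyEq ?_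
    filter_upwards [Ioi_mem_nhds hx] with y hy
    rw [← hVeq y (le_of_lt hy), inv_mul_cancel_left₀ hκ0.ne']
  have hrd : ∀ x > 0, HasDerivAt r (-β * r x + halfConv (a 0) r x) x := by
    intro x hx
    have h1 := (((hVd x hx).const_mul (κ * β)).const_sub 1).add
      (hasDerivAt_halfConv hmc hVc (hrc.const_mul κ⁻¹) hVd hx)
    refine h1.congr_deriv ?_
    have h2 : halfConv m (fun x => κ⁻¹ * r x) x = halfConv (a 0) r x := by
      simp only [halfConv, ha0]
      exact intervalIntegral.integral_congr fun t _ => by ring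
    rw [h2, hV0]
    field_simp
    ring
  refine ⟨Φ, β, a, r, fun x => κ * w x, ⟨hΦ, ?_, hchain, hmc.const_mul _, ⟨hrc, hrd⟩, ?_, ?_,
    hwc.const_mul κ, ?_, ?_, ?_⟩, ?_, ?_, ?_⟩
  · rw [hβ]; linarith [div_pos hc hκ0]
  · simp [hr, hV0, halfConv_zero]
  · intro x hx
    rw [ha0, intervalIntegral.integral_const_mul, inv_mul_le_iff₀ hκ0, hκβ]
    refine le_of_mul_le_mul_left ?_ hΦ
    refine (hρ.mul_integral_tail_le hΦ.le hx).trans ?_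
    nlinarith
  · simp only [hw0, mul_zero]
  · intro x hx y hy hxy
    simp only [hwW x hx, hwW y hy]
    exact mul_lt_mul_of_pos_left (hW.strictMonoOn hx hy hxy) hκ0
  · intro x hx
    have h1 : HasDerivAt (fun x => V x + Φ * ∫ t in (0 : ℝ)..x, w t) (κ⁻¹ * r x + Φ * w x) x :=
      (hVd x hx).add ((hwc.integral_hasStrictDerivAt 0 x).hasDerivAt.const_mul Φ)
    have h2 : (fun x => V x + Φ * ∫ t in (0 : ℝ)..x, w t) = w := by
      ext x; simp [hV, halfConv]
    rw [h2] at h1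
    refine (h1.const_mul κ).congr_deriv ?_
    field_simp
  · intro x hx
    simp only [hwW x hx]; field_simp
  · rw [hβ]; ring
  · simp only [ha0, hm, IsLevyDensity.tail_zero, hβ]
    field_simp
    linarith

end LevyTriplet

/-! ### Regularity, monotonicity and conclusion -/

theorem contDiffOn_succ_of_hasDerivAt {f f' : ℝ → ℝ} {s : Set ℝ} (hs : IsOpen s) {n : ℕ}
    (hf : ∀ x ∈ s, HasDerivAt f (f' x) x) (hf' : ContDiffOn ℝ n f' s) :
    ContDiffOn ℝ (n + 1 : ℕ) f s := by
  push_cast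
  refine (contDiffOn_succ_iff_deriv_of_isOpen hs).2
    ⟨fun x hx => (hf x hx).differentiableAt.differentiableWithinAt, by simp, ?_⟩
  exact hf'.congr fun x hx => (hf x hx).deriv

/-- If `f'(0+) > 0` and `f'` stays negative to the right of any zero, then `f` increases up to the
infimum of `{f' ≤ 0}` and decreases from there on. -/
theorem monotonicity_at_sInf {f D : ℝ → ℝ} {D₀ : ℝ} (hd : ∀ x > 0, HasDerivAt f (D x) x)
    (hD₀ : 0 < D₀) (hlim : Tendsto D (𝓝[>] 0) (𝓝 D₀))
    (hsign : ∀ x > 0, ∀ y > x, D x ≤ 0 → D y < 0) :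
    let A : EReal := sInf ((fun b : ℝ => (b : EReal)) ''
      {b : ℝ | 0 ≤ b ∧ extendZero (deriv f) b ≤ 0})
    StrictMonoOn f {b : ℝ | 0 < b ∧ (b : EReal) < A} ∧ StrictAntiOn f {b : ℝ | A < (b : EReal)} ∧
      ∀ b > 0, D b ≤ 0 → A ≤ (b : EReal) := by
  intro A
  -- The point 0 does not belong to the set because the limit D₀ of the derivative is positive.
  have hZ : {b : ℝ | 0 ≤ b ∧ extendZero (deriv f) b ≤ 0} = {b : ℝ | 0 < b ∧ D b ≤ 0} := by
    ext b
    simp only [mem_ofPred_eq, extendZero]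
    have hlim' : Tendsto (deriv f) (𝓝[>] 0) (𝓝 D₀) := by
      refine hlim.congr' ?_
      filter_upwards [self_mem_nhdsWithin] with x hx using (hd x hx).deriv.symm
    rcases eq_or_ne b 0 with rfl | hb
    · simp [hlim'.limUnder_eq, hD₀]
    · rw [if_neg hb]
      constructor
      · rintro ⟨h1, h2⟩
        have hb0 := h1.lt_of_ne hb.symm
        exact ⟨hb0, (hd b hb0).deriv ▸ h2⟩
      · rintro ⟨h1, h2⟩
        exact ⟨h1.le, by rwa [(hd b h1).deriv]⟩
  have hA : A = sInf ((fun b : ℝ => (b : EReal)) '' {b : ℝ | 0 < b ∧ D b ≤ 0}) := by rw [← hZ]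
  have hle : ∀ b > 0, D b ≤ 0 → A ≤ (b : EReal) := fun b hb hDb => by
    rw [hA]; exact sInf_le ⟨b, ⟨hb, hDb⟩, rfl⟩
  have hgt : ∀ b : ℝ, A < (b : EReal) → 0 < b ∧ D b < 0 := by
    intro b hb
    rw [hA, sInf_lt_iff] at hb
    obtain ⟨_, ⟨z, ⟨hz, hDz⟩, rfl⟩, hzb⟩ := hb
    have hzb' : z < b := EReal.coe_lt_coe_iff.1 hzb
    exact ⟨hz.trans hzb', hsign z hz b hzb' hDz⟩
  refine ⟨fun x hx y hy hxy => ?_, fun x hx y hy hxy => ?_, hle⟩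
  · have hpos : ∀ z ∈ Icc x y, 0 < D z := fun z hz => by
      by_contra! hcon
      have h1 := hle z (hx.1.trans_le hz.1) hcon
      have h2 : (z : EReal) ≤ y := by exact_mod_cast hz.2
      exact absurd hy.2 (not_lt_of_ge (h1.trans h2))
    exact strictMonoOn_of_hasDerivWithinAt_pos (convex_Icc x y)
      (fun z hz => (hd z (hx.1.trans_le hz.1)).continuousAt.continuousWithinAt)
      (fun z hz => (hd z (hx.1.trans_le (interior_subset hz).1)).hasDerivWithinAt)
      (fun z hz => hpos z (interior_subset hz)) ⟨le_rfl, hxy.le⟩ ⟨hxy.le, le_rfl⟩ hxy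
  · have hneg : ∀ z ∈ Icc x y, 0 < z ∧ D z < 0 := fun z hz => by
      refine hgt z (lt_of_lt_of_le hx ?_)
      exact_mod_cast hz.1
    exact strictAntiOn_of_hasDerivWithinAt_neg (convex_Icc x y)
      (fun z hz => (hd z (hneg z hz).1).continuousAt.continuousWithinAt)
      (fun z hz => (hd z (hneg z (interior_subset hz)).1).hasDerivWithinAt)
      (fun z hz => (hneg z (interior_subset hz)).2) ⟨le_rfl, hxy.le⟩ ⟨hxy.le, le_rfl⟩ hxy

namespace IsReducedScale

variable {Φ β : ℝ} {a : ℕ → ℝ → ℝ} {r U : ℝ → ℝ}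

/-- `U'` decreases up to the zero of `U''` and increases from there on. -/
theorem deriv₁_min (h : IsReducedScale Φ β a r U) {b : ℝ} (hb : 0 < b)
    (hb0 : negSlope Φ β (a 0) r U b = 0) :
    (∀ x ≥ 0, deriv₁ Φ r U b ≤ deriv₁ Φ r U x) ∧
      ∀ x > b, deriv₁ Φ r U b < deriv₁ Φ r U x := by
  have hanti : AntitoneOn (deriv₁ Φ r U) (Icc 0 b) := by
    refine antitoneOn_of_hasDerivWithinAt_nonpos (convex_Icc 0 b) h.continuous_deriv₁.continuousOn
      (fun x hx => (h.hasDerivAt_deriv₁ x (by rw [interior_Icc] at hx; exact hx.1)).hasDerivWithinAt)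
      fun x hx => ?_
    have hx' := interior_subset hx
    rw [deriv₂_eq]
    refine neg_nonpos.2 (mul_nonneg (Real.exp_pos _).le ?_)
    rw [← hb0]
    exact h.strictAntiOn_negSlope.antitoneOn hx'.1 (mem_Ici.2 hb.le) hx'.2
  have hmono : StrictMonoOn (deriv₁ Φ r U) (Ici b) := by
    refine strictMonoOn_of_hasDerivWithinAt_pos (convex_Ici b) h.continuous_deriv₁.continuousOn
      (fun x hx => (h.hasDerivAt_deriv₁ x (hb.trans_le (interior_subset hx))).hasDerivWithinAt)
      fun x hx => ?_
    rw [interior_Ici] at hx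
    rw [deriv₂_eq]
    refine neg_pos.2 (mul_neg_of_pos_of_neg (Real.exp_pos _) ?_)
    rw [← hb0]
    exact h.strictAntiOn_negSlope (mem_Ici.2 hb.le) (mem_Ici.2 (hb.trans hx).le) hx
  have hgt : ∀ x > b, deriv₁ Φ r U b < deriv₁ Φ r U x := fun x hx =>
    hmono (mem_Ici.2 le_rfl) (mem_Ici.2 (le_of_lt hx)) hx
  refine ⟨fun x hx => ?_, hgt⟩
  rcases le_or_gt x b with hxb | hxb
  · exact hanti ⟨hx, hxb⟩ ⟨hb.le, le_rfl⟩ hxb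
  · exact (hgt x hxb).le

end IsReducedScale

end
open IsReducedScale

theorem lemma3p4 (X : LevyTriplet) (q δ S : ℝ) (W : ℝ → ℝ)
    (hq : 0 < q) (hδ : 0 < δ) (hS : 0 < S)
    (hσ : 0 < X.σ)
    (hphi : X.phi δ q < 2 * δ / X.σ ^ 2)
    (hfin : X.jump (Ioi 0) < ⊤)
    (hcm : X.HasCompletelyMonotoneDensity)
    (hSc : S < X.drift / (X.jump.real (Ioi 0) + q))
    (hW : X.IsScaleFunction q W) :
    ContDiffOn ℝ 3 W (Ioi 0) ∧
    (∀ b : ℝ, 0 < b → 0 < deriv W b) ∧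
    (∃ l : ℝ, Tendsto (deriv W) (𝓝[>] 0) (𝓝 l)) ∧
    (∃ l : ℝ, Tendsto (deriv (thetaS X.σ S W)) (𝓝[>] 0) (𝓝 l)) ∧
    ∃ aStar : ℝ, IsGreatest (derivMinimizers W) aStar ∧
      StrictMonoOn (thetaS X.σ S W) {b : ℝ | 0 < b ∧ (b : EReal) < aStarS X.σ S W} ∧
      StrictAntiOn (thetaS X.σ S W) {b : ℝ | aStarS X.σ S W < (b : EReal)} ∧
      aStarS X.σ S W ≤ (aStar : EReal) := by
  have hlq : 0 < X.jump.real (Ioi 0) + q := add_pos_of_nonneg_of_pos measureReal_nonneg hq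
  rw [lt_div_iff₀ hlq] at hSc
  have hdrift : 0 < X.drift := (mul_pos hS hlq).trans hSc
  obtain ⟨Φ, β, a, r, U, h, hWU, hβΦ, hm0⟩ := hW.exists_reduced hq hσ hfin hcm hdrift
  set κ := X.σ ^ 2 / 2 with hκ
  have hκ0 : 0 < κ := by positivity
  set G := deriv₁ Φ r U with hG
  set G₁ := deriv₂ Φ β (a 0) r U with hG₁
  set G₂ := deriv₃ Φ β (a 0) r U with hG₂
  have hGpos := h.deriv₁_pos
  have hd₁ : ∀ x > 0, HasDerivAt W (G x / κ) x := fun x hx => by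
    refine ((h.hasDerivAt x hx).div_const κ).congr_of_eventuallyEq ?_
    filter_upwards [Ioi_mem_nhds hx] with y hy using hWU y (le_of_lt hy)
  have hd₂ : ∀ x > 0, HasDerivAt (fun x => G x / κ) (G₁ x / κ) x := fun x hx =>
    (h.hasDerivAt_deriv₁ x hx).div_const κ
  have hd₃ : ∀ x > 0, HasDerivAt (fun x => G₁ x / κ) (G₂ x / κ) x := fun x hx =>
    (h.hasDerivAt_deriv₂ x hx).div_const κ
  have hW₂ : ∀ x > 0, iteratedDeriv 2 W x = G₁ x / κ := fun x hx => by
    rw [iteratedDeriv_succ, iteratedDeriv_one]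
    refine ((hd₂ x hx).congr_of_eventuallyEq ?_).deriv
    filter_upwards [Ioi_mem_nhds hx] with y hy using (hd₁ y hy).deriv
  have hθ : ∀ x > 0, thetaS X.σ S W x = κ * ((1 - S * G₁ x) / G x) := fun x hx => by
    have := (hGpos x hx.le).ne'
    rw [thetaS, hW₂ x hx, (hd₁ x hx).deriv, ← hκ]
    field_simp
  set N := numerator Φ β S (a 0) r U with hN
  set D : ℝ → ℝ := fun x => κ * (Real.exp (Φ * x) * N x / G x ^ 2) with hD
  have hθd : ∀ x > 0, HasDerivAt (thetaS X.σ S W) (D x) x := fun x hx => by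
    refine ((h.hasDerivAt_ratio S x hx).const_mul κ).congr_of_eventuallyEq ?_
    filter_upwards [Ioi_mem_nhds hx] with y hy using hθ y hy
  have hDneg : ∀ x > 0, N x < 0 → D x < 0 := fun x hx hNx =>
    mul_neg_of_pos_of_neg hκ0 (div_neg_of_neg_of_pos
      (mul_neg_of_pos_of_neg (Real.exp_pos _) hNx) (pow_pos (hGpos x hx.le) 2))
  have hNneg : ∀ x > 0, D x ≤ 0 → N x ≤ 0 := fun x hx hDx => by
    by_contra! hcon
    exact absurd hDx (not_le_of_gt (mul_pos hκ0 (div_pos (mul_pos (Real.exp_pos _) hcon)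
      (pow_pos (hGpos x hx.le) 2))))
  -- The strict bound on S is what makes θ_S increase near 0.
  have hN0 : 0 < N 0 := by
    rw [hN, h.numerator_zero, hβΦ, hm0, mul_div_assoc', ← sub_div]
    exact div_pos (by linarith) hκ0
  have hD0 : D 0 = κ * N 0 := by simp [hD, hG, h.deriv₁_zero]
  have hDlim : Tendsto D (𝓝[>] 0) (𝓝 (D 0)) := by
    have hc : ContinuousAt D 0 := continuousAt_const.mul
      (((by fun_prop : Continuous fun x => Real.exp (Φ * x)).mul
        (h.continuous_numerator S)).continuousAt.div
        (h.continuous_deriv₁.pow 2).continuousAt (pow_ne_zero 2 (hGpos 0 le_rfl).ne'))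
    exact hc.tendsto.mono_left nhdsWithin_le_nhds
  have hWlim : Tendsto (deriv W) (𝓝[>] 0) (𝓝 (G 0 / κ)) := by
    have hc : Tendsto (fun x => G x / κ) (𝓝[>] 0) (𝓝 (G 0 / κ)) :=
      ((h.continuous_deriv₁.div_const κ).tendsto 0).mono_left nhdsWithin_le_nhds
    refine hc.congr' ?_
    filter_upwards [self_mem_nhdsWithin] with x hx using (hd₁ x hx).deriv.symm
  have hext : ∀ x ≥ 0, extendZero (deriv W) x = G x / κ := fun x hx => by
    rcases hx.lt_or_eq with hx | hx
    · rw [extendZero, if_neg hx.ne', (hd₁ x hx).deriv]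
    · rw [← hx, extendZero, if_pos rfl, hWlim.limUnder_eq]
  -- The zero of U'' is the largest minimizer of W'. The numerator is negative there, which places
  -- a_S* at or to the left of it.
  obtain ⟨b, hb, hb0⟩ := h.exists_negSlope_eq_zero
  obtain ⟨hmin, hmin'⟩ := h.deriv₁_min hb hb0
  have hcd : ContDiffOn ℝ 3 W (Ioi 0) := by
    have h0 : ContDiffOn ℝ ((0 : ℕ) : ℕ∞ω) (fun x => G₂ x / κ) (Ioi 0) := by
      rw [Nat.cast_zero, contDiffOn_zero]
      exact (h.continuous_deriv₃.div_const κ).continuousOn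
    exact_mod_cast contDiffOn_succ_of_hasDerivAt isOpen_Ioi hd₁
      (contDiffOn_succ_of_hasDerivAt isOpen_Ioi hd₂
        (contDiffOn_succ_of_hasDerivAt isOpen_Ioi hd₃ h0))
  obtain ⟨hmono, hanti, hle⟩ := monotonicity_at_sInf hθd (by rw [hD0]; positivity) hDlim
    fun x hx y hy hDx => hDneg y (hx.trans hy)
      (h.numerator_neg_of_lt hS hN0 hx hy (hNneg x hx hDx))
  refine ⟨hcd, fun x hx => ?_, ⟨_, hWlim⟩, ⟨D 0, ?_⟩, b, ⟨⟨hb.le, fun x hx => ?_⟩, fun x hx => ?_⟩,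
    hmono, hanti, hle b hb (hDneg b hb (h.numerator_neg_of_ge hS hb hb0.le)).le⟩
  · rw [(hd₁ x hx).deriv]; exact div_pos (hGpos x hx.le) hκ0
  · refine hDlim.congr' ?_
    filter_upwards [self_mem_nhdsWithin] with x hx using (hθd x hx).deriv.symm
  · rw [hext b hb.le, hext x hx]
    exact div_le_div_of_nonneg_right (hmin x hx) hκ0.le
  · by_contra! hcon
    have h1 := hx.2 b hb.le
    rw [hext b hb.le, hext x hx.1] at h1
    exact absurd h1 (not_le_of_gt (div_lt_div_of_pos_right (hmin' x hcon) hκ0))
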